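/- A boundary operator of size $n$ is a matrix $\delta\in\mathbb F_2^{n\times n}$ with $\delta^2=0$; its homological dimension is $H(\delta)=\dim\ker\delta-\dim\operatorname{im}\delta$. A nontrivial cycle of $\delta$ is a vector in $\ker\delta\setminus\operatorname{im}\delta$, and a nontrivial cocycle is a vector in $\ker\delta^T\setminus\operatorname{im}\delta^T$. The distance of the code defined by $\delta$ is the minimum Hamming weight of a nontrivial cycle or nontrivial cocycle ($\infty$ if there is none). There exist constants $c_0>0$ and $\rho_0>0$ such that for every $0<c\le c_0$ the following holds. Let $M=2L+H$ with integers $L,H\ge 0$ and encoding rate $\rho_{enc}=H/M\le\rho_0$, and let $\delta_1,\delta_2$ be independent random matrices, each uniformly distributed on the set of $M\times M$ boundary operators over $\mathbb F_2$ with homological dimension $H=\rho_{enc}M$. Let $\partial=\delta_1\otimes I+I\otimes\delta_2$ be the $M^2\times M^2$ boundary operator of the product complex. Then $$\Pr\bigl[\text{the code defined by }\partial\text{ has distance less than }cM^2\bigr]=o(1)\qquad(M\to\infty),$$ uniformly in $H$: for every $\varepsilon>0$ there is $M_0$ such that this probability is at most $\varepsilon$ for all $M\ge M_0$ and all $H\le\rho_0M$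 with $M-H$ even and nonnegative. -/

import Mathlib

open scoped Kronecker ENNReal

/-! Single-sector chain complexes over `F₂`: a complex is the space `F₂ⁿ` with its standard basis
and a square matrix `δ` with `δ * δ = 0` (the boundary operator), acting by `v ↦ δ v`. -/

/-- Cycles of `δ`: the kernel of `v ↦ δ v`. The cocycles are the cycles of `δᵀ`. -/
def cycles {n : Type*} [Fintype n] (δ : Matrix n n (ZMod 2)) : Submodule (ZMod 2) (n → ZMod 2) :=
  LinearMap.ker δ.mulVecLin

/-- Trivial cycles of `δ`: the image of `v ↦ δ v`. -/
def trivialCycles {n : Type*} [Fintype n] (δ : Matrix n n (ZMod 2)) :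
    Submodule (ZMod 2) (n → ZMod 2) :=
  LinearMap.range δ.mulVecLin

/-- Every trivial cycle of a boundary operator is a cycle. -/
theorem trivialCycles_le_cycles {n : Type*} [Fintype n] {δ : Matrix n n (ZMod 2)}
    (h : δ * δ = 0) : trivialCycles δ ≤ cycles δ := by
  rintro _ ⟨v, rfl⟩
  simp [cycles, Matrix.mulVec_mulVec, h]

/-- The homological dimension `dim (ker δ) - dim (im δ)`. The subtraction does not truncate for a
boundary operator, because then `im δ ⊆ ker δ`. -/
noncomputable def homologicalDim {n : Type*} [Fintype n] (δ : Matrix n n (ZMod 2)) : ℕ :=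
  Module.finrank (ZMod 2) (cycles δ) - Module.finrank (ZMod 2) (trivialCycles δ)

/-- The minimum weight of a nontrivial cycle (a vector of `ker δ \ im δ`), and `⊤` if there is
none. The weight `hammingNorm v` is the number of nonzero entries of `v`. -/
noncomputable def cycleDistance {n : Type*} [Fintype n] (δ : Matrix n n (ZMod 2)) : ℕ∞ :=
  ⨅ v ∈ {v : n → ZMod 2 | v ∈ cycles δ ∧ v ∉ trivialCycles δ}, (hammingNorm v : ℕ∞)

/-- The distance of the CSS code of the complex `δ`: the minimum weight of a nontrivial cycle or
nontrivial cocycle. -/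
noncomputable def codeDistance {n : Type*} [Fintype n] (δ : Matrix n n (ZMod 2)) : ℕ∞ :=
  min (cycleDistance δ) (cycleDistance δ.transpose)

/-- The boundary operator `δ₁ ⊗ I + I ⊗ δ₂` of the product complex, in the product basis. -/
def productBoundary {m n : Type*} [DecidableEq m] [DecidableEq n]
    (δ₁ : Matrix m m (ZMod 2)) (δ₂ : Matrix n n (ZMod 2)) : Matrix (m × n) (m × n) (ZMod 2) :=
  δ₁ ⊗ₖ (1 : Matrix n n (ZMod 2)) + (1 : Matrix m m (ZMod 2)) ⊗ₖ δ₂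

open Classical in
/-- The finite set of `M × M` boundary operators over `F₂` with homological dimension `H`. -/
noncomputable def boundaryOperators (M H : ℕ) : Finset (Matrix (Fin M) (Fin M) (ZMod 2)) :=
  {δ | δ * δ = 0 ∧ homologicalDim δ = H}

open Classical in
/-- The probability that the product code of `δ₁` and `δ₂` has distance less than `c * M ^ 2`,
when `δ₁` and `δ₂` are independent and uniformly distributed on `boundaryOperators M H`: the number
of such pairs divided by the number of all pairs. -/
noncomputable def probDistanceLT (M H : ℕ) (c : ℝ) : ℝ :=
  (((boundaryOperators M H ×ˢ boundaryOperators M H).filter fun p =>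
      (codeDistance (productBoundary p.1 p.2) : ℝ≥0∞) < ENNReal.ofReal (c * (M : ℝ) ^ 2)).card : ℝ) /
    ((boundaryOperators M H ×ˢ boundaryOperators M H).card : ℝ)

/-! A chain of the product complex is an `M × M` matrix `ψ`, and it is a cycle exactly when `δ₁ * ψ
= ψ * δ₂ᵀ`. Nontrivial cycles of weight below `(w + 1) ^ 2`, with `w` a small multiple of `M`, are
excluded according to their rank.

Rank above `R`, about `M / 32`: for fixed `ψ` and `δ₂` the equation forces `δ₁` to vanish on a fixed
space of dimension about `R / 2`, which has probability about `2 ^ (-L * R / 2)`. This beats the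
number of light matrices (`card_mul_eq_mul_le`, `card_light_cycle_of_rank_mul_le`).

Rank at most `R`: at most `w` rows `S` and `w` columns `T` are heavy. Erase them to get `φ`. Modulo
the subcomplexes generated by `e_S` and `e_T`, `φ` intertwines the boundary operators, so at least a
third of its column space or of its row space consists of relative cycles (`rank_eraseRowsCols_le`).
With high probability no nonzero space of dimension at most `R` spanned by light vectors has so many
(`HasFewLightCycles`, `card_not_hasFewLightCycles_mul_le`), so `φ = 0`. Then `ψ` lives on `S` and
`T`, and two homotopies show that it is a boundary (`exists_boundary_of_eraseRowsCols_eq_zero`).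

The probability estimates for a random `δ` rest on `card_filter_mul_two_pow_le`: its law is
invariant under conjugation, so a fixed independent family can be replaced by an average over all of
them. Cocycles follow by transposition. -/

/-! ### Size of Hamming balls. -/

/-- Hamming balls of small relative radius have small exponential rate. -/
theorem exists_card_hammingBall_le {h : ℝ} (hh : 0 < h) :
    ∃ θ : ℝ, 0 < θ ∧ ∀ (ι : Type) [Fintype ι],
      (((Finset.univ : Finset (Finset ι)).filter
        fun s => (s.card : ℝ) ≤ θ * (Fintype.card ι : ℝ)).card : ℝ) ≤
        (2 : ℝ) ^ (h * (Fintype.card ι : ℝ)) := by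
  -- Exponential weighting: the sets `s` have total weight `∑ q ^ |s| = (1 + q) ^ N`, and each `s`
  -- in the ball weighs at least `q ^ (θ N)`. The parameters `q` and `θ` split the rate `h` evenly
  -- between these two factors.
  obtain ⟨q, hq0, hq1, hq⟩ : ∃ q : ℝ, 0 < q ∧ q < 1 ∧ 1 + q ≤ (2 : ℝ) ^ (h / 2) := by
    have : (1 : ℝ) < (2 : ℝ) ^ (h / 2) := Real.one_lt_rpow (by norm_num) (by positivity)
    refine ⟨min (2 ^ (h / 2) - 1) (1 / 2), lt_min (by linarith) (by norm_num),
      (min_le_right _ _).trans_lt (by norm_num), ?_⟩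
    linarith [min_le_left ((2 : ℝ) ^ (h / 2) - 1) (1 / 2)]
  have hlq : Real.log q < 0 := Real.log_neg hq0 hq1
  have hl2 : 0 < Real.log 2 := Real.log_pos (by norm_num)
  set θ : ℝ := (h / 2) * Real.log 2 / (- Real.log q) with hθ
  have hθ0 : 0 < θ := by
    have : 0 < - Real.log q := by linarith
    positivity
  have hqθ : q ^ θ = (2 : ℝ) ^ (-(h / 2)) := by
    rw [Real.rpow_def_of_pos hq0, Real.rpow_def_of_pos (by norm_num : (0 : ℝ) < 2)]
    congr 1
    rw [hθ]
    field_simp [hlq.ne]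
  refine ⟨θ, hθ0, fun ι _ => ?_⟩
  set N : ℝ := (Fintype.card ι : ℝ) with hN
  have key : ∑ s : Finset ι, q ^ s.card = (q + 1) ^ (Fintype.card ι) := by
    have := Finset.sum_pow_mul_eq_add_pow q 1 (Finset.univ : Finset ι)
    simpa using this
  have h1 : (((Finset.univ : Finset (Finset ι)).filter
      fun s => (s.card : ℝ) ≤ θ * N).card : ℝ) * q ^ (θ * N) ≤ (q + 1) ^ (Fintype.card ι) := by
    rw [← key, ← nsmul_eq_mul, ← Finset.sum_const]
    refine (Finset.sum_le_sum fun s hs => ?_).trans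
      (Finset.sum_le_sum_of_subset_of_nonneg (Finset.filter_subset _ _) fun s _ _ => by positivity)
    rw [← Real.rpow_natCast]
    exact Real.rpow_le_rpow_of_exponent_ge hq0 hq1.le (by simpa using hs)
  have h2 : (q + 1) ^ (Fintype.card ι) ≤ (2 : ℝ) ^ (h / 2 * N) := by
    rw [Real.rpow_mul (by norm_num), hN, Real.rpow_natCast]
    exact pow_le_pow_left₀ (by positivity) (by linarith) _
  have h3 : q ^ (θ * N) = (2 : ℝ) ^ (-(h / 2 * N)) := by
    rw [Real.rpow_mul hq0.le, hqθ, ← Real.rpow_mul (by norm_num)]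
    congr 1
    ring
  rw [h3, Real.rpow_neg (by norm_num)] at h1
  have h4 : 0 < (2 : ℝ) ^ (h / 2 * N) := by positivity
  calc _ ≤ (q + 1) ^ (Fintype.card ι) * (2 : ℝ) ^ (h / 2 * N) := by
        rwa [← div_eq_mul_inv, div_le_iff₀ h4] at h1
    _ ≤ (2 : ℝ) ^ (h / 2 * N) * (2 : ℝ) ^ (h / 2 * N) := by gcongr
    _ = (2 : ℝ) ^ (h * N) := by
        rw [← Real.rpow_add (by norm_num)]
        congr 1
        ring

theorem ZMod.two_eq_of_ne_zero_iff {a b : ZMod 2} (h : a ≠ 0 ↔ b ≠ 0) : a = b := by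
  revert a b; decide

/-- The number of binary vectors of weight at most `w` is at most the number of supports. -/
theorem card_hammingNorm_le {ι : Type} [Fintype ι] [DecidableEq ι] (p : ℕ → Prop)
    [DecidablePred p] :
    ((Finset.univ : Finset (ι → ZMod 2)).filter fun x => p (hammingNorm x)).card ≤
      ((Finset.univ : Finset (Finset ι)).filter fun s => p s.card).card := by
  refine Finset.card_le_card_of_injOn (fun x => Finset.univ.filter fun i => x i ≠ 0) ?_ ?_
  · intro x hx
    simpa [hammingNorm] using hx
  · intro x _ y _ hxy
    ext1 i
    apply ZMod.two_eq_of_ne_zero_iff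
    have := congrArg (fun s => i ∈ s) hxy
    simpa using this

/-! ### Boundary operators of given rank, and their symmetries. -/

theorem finrank_map_add_finrank_inf_ker {K V V' : Type*} [Field K] [AddCommGroup V] [Module K V]
    [FiniteDimensional K V] [AddCommGroup V'] [Module K V'] (f : V →ₗ[K] V') (p : Submodule K V) :
    Module.finrank K (p.map f) + Module.finrank K (p ⊓ LinearMap.ker f : Submodule K V) =
      Module.finrank K p := by
  have h := (f.domRestrict p).finrank_range_add_finrank_ker
  rw [LinearMap.range_domRestrict, LinearMap.ker_domRestrict] at h
  rw [← h, ← Submodule.finrank_map_subtype_eq, Submodule.map_comap_subtype]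

theorem finrank_cycles_add_rank {M : ℕ} (δ : Matrix (Fin M) (Fin M) (ZMod 2)) :
    Module.finrank (ZMod 2) (cycles δ) + δ.rank = M := by
  have := δ.mulVecLin.finrank_range_add_finrank_ker
  rw [Module.finrank_fin_fun] at this
  rw [cycles, Matrix.rank]
  omega

/-- By rank–nullity the homological dimension is `M - 2 * rank δ`, so fixing it fixes the rank,
which is visibly invariant under conjugation and transposition. -/
theorem mem_boundaryOperators {M L H : ℕ} (hM : M = 2 * L + H) {δ : Matrix (Fin M) (Fin M) (ZMod 2)} :
    δ ∈ boundaryOperators M H ↔ δ * δ = 0 ∧ δ.rank = L := by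
  simp only [boundaryOperators, Finset.mem_filter, Finset.mem_univ, true_and]
  refine and_congr_right fun h => ?_
  have h1 := finrank_cycles_add_rank δ
  have h2 := Submodule.finrank_mono (trivialCycles_le_cycles h)
  have h3 : Module.finrank (ZMod 2) (trivialCycles δ) = δ.rank := rfl
  rw [homologicalDim]
  omega

theorem transpose_mem_boundaryOperators {M L H : ℕ} (hM : M = 2 * L + H)
    {δ : Matrix (Fin M) (Fin M) (ZMod 2)}
    (h : δ ∈ boundaryOperators M H) : δ.transpose ∈ boundaryOperators M H := by
  rw [mem_boundaryOperators hM] at *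
  rw [Matrix.rank_transpose, ← Matrix.transpose_mul, h.1]
  exact ⟨Matrix.transpose_zero, h.2⟩

theorem conj_mem_boundaryOperators {M L H : ℕ} (hM : M = 2 * L + H)
    {δ g g' : Matrix (Fin M) (Fin M) (ZMod 2)} (hg : g' * g = 1)
    (h : δ ∈ boundaryOperators M H) :
    g * δ * g' ∈ boundaryOperators M H := by
  rw [mem_boundaryOperators hM] at *
  constructor
  · calc g * δ * g' * (g * δ * g') = g * δ * (g' * g) * δ * g' := by simp only [Matrix.mul_assoc]
      _ = g * (δ * δ) * g' := by simp only [hg, Matrix.mul_assoc, Matrix.one_mul]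
      _ = 0 := by rw [h.1]; simp
  · have h1 : IsUnit g.det := Matrix.isUnit_det_of_left_inverse hg
    have h2 : IsUnit g'.det := Matrix.isUnit_det_of_right_inverse hg
    rw [Matrix.rank_mul_eq_left_of_isUnit_det _ _ h2, Matrix.rank_mul_eq_right_of_isUnit_det _ _ h1,
      h.2]

/-! ### Averaging over the general linear group. -/

theorem LinearIndependent.exists_linearEquiv {K V ι : Type*} [Field K] [AddCommGroup V]
    [Module K V] [FiniteDimensional K V] [Finite ι] {u v : ι → V} (hu : LinearIndependent K u)
    (hv : LinearIndependent K v) : ∃ g : V ≃ₗ[K] V, ∀ i, g (u i) = v i := by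
  classical
  let bu := Module.Basis.sumExtend hu
  let bv := Module.Basis.sumExtend hv
  have := Fintype.ofFinite ι
  have hfu := Module.Finite.finite_basis bu
  have hfv := Module.Finite.finite_basis bv
  have : Finite (Module.Basis.sumExtendIndex hu) := Finite.sum_right ι
  have : Finite (Module.Basis.sumExtendIndex hv) := Finite.sum_right ι
  have hc : Nat.card (Module.Basis.sumExtendIndex hu) =
      Nat.card (Module.Basis.sumExtendIndex hv) := by
    have h1 := Module.finrank_eq_nat_card_basis bu
    have h2 := Module.finrank_eq_nat_card_basis bv
    rw [Nat.card_sum] at h1 h2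
    omega
  obtain ⟨e⟩ := Finite.card_eq.mp hc
  refine ⟨bu.equiv bv (Equiv.sumCongr (Equiv.refl ι) e), fun i => ?_⟩
  have h1 : u i = bu (Sum.inl i) := by
    simp [bu, Module.Basis.sumExtend]
    rfl
  have h2 : v i = bv (Sum.inl i) := by
    simp [bv, Module.Basis.sumExtend]
    rfl
  rw [h1, h2, Module.Basis.equiv_apply]
  rfl

/-- The exact count is a product of factors `2 ^ M - 2 ^ i` with `i < M`, each at least `2 ^ (M -
1)`. -/
theorem two_pow_le_card_linearIndependent {M : ℕ} {ι : Type} [Fintype ι] [DecidableEq ι]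
    [DecidablePred fun a : ι → Fin M → ZMod 2 => LinearIndependent (ZMod 2) a]
    (hι : Fintype.card ι ≤ M) :
    2 ^ ((M - 1) * Fintype.card ι) ≤ ((Finset.univ : Finset (ι → Fin M → ZMod 2)).filter
      fun a => LinearIndependent (ZMod 2) a).card := by
  have h1 : ((Finset.univ : Finset (ι → Fin M → ZMod 2)).filter
      fun a => LinearIndependent (ZMod 2) a).card =
      Nat.card {s : Fin (Fintype.card ι) → Fin M → ZMod 2 // LinearIndependent (ZMod 2) s} := by
    rw [← Fintype.card_subtype, ← Nat.card_eq_fintype_card]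
    refine Nat.card_congr (Equiv.subtypeEquiv
      (Equiv.arrowCongr (Fintype.equivFin ι) (Equiv.refl _)) fun a => ?_)
    exact (linearIndependent_equiv (Fintype.equivFin ι).symm).symm
  rw [h1, card_linearIndependent (by simpa using hι), pow_mul, ← Finset.card_fin (Fintype.card ι),
    ← Finset.prod_const, Finset.card_fin]
  refine Finset.prod_le_prod' fun i _ => ?_
  rw [ZMod.card, Module.finrank_fin_fun]
  have hi : (i : ℕ) ≤ M - 1 := by omega
  have h2 : 2 ^ (i : ℕ) ≤ 2 ^ (M - 1) := Nat.pow_le_pow_right (by norm_num) hi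
  have h3 : 2 ^ M = 2 ^ (M - 1) * 2 := by rw [← pow_succ]; congr 1; omega
  omega

open Classical in
/-- For a conjugation invariant set of matrices, the number of matrices in an equivariant relation
to a fixed independent family is bounded by averaging over all independent families. -/
theorem card_filter_mul_two_pow_le {M : ℕ} {ι : Type} [Fintype ι] [DecidableEq ι]
    (Ω : Finset (Matrix (Fin M) (Fin M) (ZMod 2)))
    (hΩ : ∀ g g' : Matrix (Fin M) (Fin M) (ZMod 2), g' * g = 1 → ∀ δ ∈ Ω, g * δ * g' ∈ Ω)
    (Q : Matrix (Fin M) (Fin M) (ZMod 2) → (ι → Fin M → ZMod 2) → Prop)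
    [∀ δ a, Decidable (Q δ a)]
    (hQ : ∀ g g' δ : Matrix (Fin M) (Fin M) (ZMod 2), ∀ a, g' * g = 1 → Q δ a →
      Q (g * δ * g') fun i => g.mulVec (a i))
    {a₀ : ι → Fin M → ZMod 2} (h₀ : LinearIndependent (ZMod 2) a₀) {N : ℕ}
    (hN : ∀ δ ∈ Ω, (Finset.univ.filter fun a => Q δ a).card ≤ N) :
    (Ω.filter fun δ => Q δ a₀).card * 2 ^ ((M - 1) * Fintype.card ι) ≤ Ω.card * N := by
  have hι : Fintype.card ι ≤ M := by simpa using h₀.fintype_card_le_finrank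
  set I := (Finset.univ : Finset (ι → Fin M → ZMod 2)).filter fun a => LinearIndependent (ZMod 2) a
  -- Conjugation by an automorphism that carries `a₀` to `a` injects the matrices related to `a₀`
  -- into those related to `a`.
  have hle : ∀ a ∈ I, (Ω.filter fun δ => Q δ a₀).card ≤ (Ω.filter fun δ => Q δ a).card := by
    intro a ha
    obtain ⟨e, he⟩ := h₀.exists_linearEquiv (Finset.mem_filter.mp ha).2
    set g := LinearMap.toMatrix' e.toLinearMap
    set g' := LinearMap.toMatrix' e.symm.toLinearMap
    have hg : g' * g = 1 := by
      rw [← LinearMap.toMatrix'_comp]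
      simp
    have hga : ∀ i, g.mulVec (a₀ i) = a i := fun i => by
      rw [← Matrix.toLin'_apply, Matrix.toLin'_toMatrix']
      exact he i
    refine Finset.card_le_card_of_injOn (fun δ => g * δ * g') ?_ ?_
    · intro δ hδ
      have hδ' := Finset.mem_filter.mp hδ
      refine Finset.mem_coe.mpr (Finset.mem_filter.mpr ⟨hΩ g g' hg δ hδ'.1, ?_⟩)
      have := hQ g g' δ a₀ hg hδ'.2
      simpa only [hga] using this
    · intro δ _ δ' _ h
      have h2 : ∀ x : Matrix (Fin M) (Fin M) (ZMod 2), g' * (g * x * g') * g = x := fun x => by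
        calc g' * (g * x * g') * g = (g' * g) * x * (g' * g) := by simp only [Matrix.mul_assoc]
          _ = x := by rw [hg, Matrix.one_mul, Matrix.mul_one]
      rw [← h2 δ, ← h2 δ']
      exact congrArg (fun x => g' * x * g) h
  calc _ ≤ (Ω.filter fun δ => Q δ a₀).card * I.card :=
        Nat.mul_le_mul_left _ (two_pow_le_card_linearIndependent hι)
    _ = ∑ a ∈ I, (Ω.filter fun δ => Q δ a₀).card := by simp [mul_comm]
    _ ≤ ∑ a ∈ I, (Ω.filter fun δ => Q δ a).card := Finset.sum_le_sum hle
    _ ≤ ∑ a : ι → Fin M → ZMod 2, (Ω.filter fun δ => Q δ a).card :=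
        Finset.sum_le_sum_of_subset (Finset.subset_univ _)
    _ = ∑ δ ∈ Ω, (Finset.univ.filter fun a => Q δ a).card := by
        simp only [Finset.card_filter]
        exact Finset.sum_comm
    _ ≤ Ω.card * N := by simpa using Finset.sum_le_sum hN

/-! ### Relative cycles of a random boundary operator. -/

/-- The subcomplex generated by a family of vectors. -/
def generatedSubcomplex {M : ℕ} {ι : Type} (δ : Matrix (Fin M) (Fin M) (ZMod 2))
    (s : ι → Fin M → ZMod 2) : Submodule (ZMod 2) (Fin M → ZMod 2) :=
  Submodule.span (ZMod 2) (Set.range s) ⊔ (Submodule.span (ZMod 2) (Set.range s)).map δ.mulVecLin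

/-- The vectors whose boundary lies in the subcomplex generated by `s`. -/
def relativeCycles {M : ℕ} {ι : Type} (δ : Matrix (Fin M) (Fin M) (ZMod 2))
    (s : ι → Fin M → ZMod 2) : Submodule (ZMod 2) (Fin M → ZMod 2) :=
  (generatedSubcomplex δ s).comap δ.mulVecLin

theorem generatedSubcomplex_le_relativeCycles {M : ℕ} {ι : Type}
    {δ : Matrix (Fin M) (Fin M) (ZMod 2)} (hδ : δ * δ = 0) (s : ι → Fin M → ZMod 2) :
    generatedSubcomplex δ s ≤ relativeCycles δ s := by
  rw [relativeCycles, ← Submodule.map_le_iff_le_comap, generatedSubcomplex, Submodule.map_sup,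
    ← Submodule.map_comp]
  have : δ.mulVecLin ∘ₗ δ.mulVecLin = 0 := by rw [← Matrix.mulVecLin_mul, hδ, Matrix.mulVecLin_zero]
  rw [this, Submodule.map_zero, sup_bot_eq]
  exact le_sup_right

/-- `δ` maps the relative cycles into the generated subcomplex, of dimension at most `2 * card ι`,
and the kernel of this map lies in `cycles δ`. -/
theorem finrank_relativeCycles_le {M : ℕ} {ι : Type} [Fintype ι]
    (δ : Matrix (Fin M) (Fin M) (ZMod 2)) (s : ι → Fin M → ZMod 2) :
    Module.finrank (ZMod 2) (relativeCycles δ s) + δ.rank ≤ M + 2 * Fintype.card ι := by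
  have h1 := finrank_map_add_finrank_inf_ker δ.mulVecLin (relativeCycles δ s)
  have h2 : (relativeCycles δ s).map δ.mulVecLin ≤ generatedSubcomplex δ s :=
    Submodule.map_comap_le _ _
  have h3 := Submodule.finrank_mono h2
  have h4 : Module.finrank (ZMod 2) (relativeCycles δ s ⊓ LinearMap.ker δ.mulVecLin : Submodule _ _)
      ≤ Module.finrank (ZMod 2) (cycles δ) := Submodule.finrank_mono inf_le_right
  have h5 := finrank_cycles_add_rank δ
  have h6 := Submodule.finrank_add_le_finrank_add_finrank (Submodule.span (ZMod 2) (Set.range s))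
    ((Submodule.span (ZMod 2) (Set.range s)).map δ.mulVecLin)
  have h7 := Submodule.finrank_map_le δ.mulVecLin (Submodule.span (ZMod 2) (Set.range s))
  have h8 := finrank_range_le_card (R := ZMod 2) s
  rw [Set.finrank] at h8
  rw [← generatedSubcomplex] at h6
  omega

theorem mem_relativeCycles_conj {M : ℕ} {ι : Type} {g g' δ : Matrix (Fin M) (Fin M) (ZMod 2)}
    (hg : g' * g = 1) {s : ι → Fin M → ZMod 2} {x : Fin M → ZMod 2} (hx : x ∈ relativeCycles δ s) :
    g.mulVec x ∈ relativeCycles (g * δ * g') fun i => g.mulVec (s i) := by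
  have h1 : (g * δ * g').mulVecLin ∘ₗ g.mulVecLin = g.mulVecLin ∘ₗ δ.mulVecLin := by
    rw [← Matrix.mulVecLin_mul, ← Matrix.mulVecLin_mul, Matrix.mul_assoc, hg, Matrix.mul_one]
  have h2 : generatedSubcomplex (g * δ * g') (fun i => g.mulVec (s i)) =
      (generatedSubcomplex δ s).map g.mulVecLin := by
    have : Submodule.span (ZMod 2) (Set.range fun i => g.mulVec (s i)) =
        (Submodule.span (ZMod 2) (Set.range s)).map g.mulVecLin := by
      rw [Submodule.map_span, ← Set.range_comp]
      rfl
    rw [generatedSubcomplex, generatedSubcomplex, Submodule.map_sup, this, ← Submodule.map_comp, h1,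
      Submodule.map_comp]
  rw [relativeCycles, Submodule.mem_comap, h2]
  have h3 := LinearMap.congr_fun h1 x
  simp only [LinearMap.comp_apply, Matrix.mulVecLin_apply] at h3 ⊢
  rw [h3]
  exact Submodule.mem_map_of_mem (f := g.mulVecLin) hx

open Classical in
/-- The fraction of boundary operators for which `k` given vectors, independent of each other and of
`s`, are relative cycles, is about `2 ^ (- L * k)`. -/
theorem card_relativeCycles_mul_le {M L H : ℕ} (hM : M = 2 * L + H) {ι : Type} [Fintype ι] [DecidableEq ι] {k : ℕ}
    {s : ι → Fin M → ZMod 2} {a : Fin k → Fin M → ZMod 2}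
    (h : LinearIndependent (ZMod 2) (Sum.elim s a)) :
    ((boundaryOperators M H).filter fun δ => ∀ i, a i ∈ relativeCycles δ s).card *
      2 ^ (L * k) ≤ (boundaryOperators M H).card *
        2 ^ (Fintype.card ι + k * (1 + 2 * Fintype.card ι)) := by
  set t := Fintype.card ι with ht
  -- The vectors of `s` are free, and each of the other `k` lies in a space of dimension at most `M
  -- - L + 2 * t`.
  have hN : ∀ δ ∈ boundaryOperators M H, (Finset.univ.filter fun b : ι ⊕ Fin k → Fin M → ZMod 2 =>
      ∀ i, b (Sum.inr i) ∈ relativeCycles δ fun j => b (Sum.inl j)).card ≤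
      2 ^ (M * t) * 2 ^ ((M - L + 2 * t) * k) := by
    intro δ hδ
    have hr := ((mem_boundaryOperators hM).mp hδ).2
    have e1 : (Finset.univ.filter fun b : ι ⊕ Fin k → Fin M → ZMod 2 =>
        ∀ i, b (Sum.inr i) ∈ relativeCycles δ fun j => b (Sum.inl j)).card =
        ((Finset.univ : Finset (ι → Fin M → ZMod 2)).sigma fun u =>
          (Fintype.piFinset fun _ : Fin k => Finset.univ.filter fun x => x ∈ relativeCycles δ u)).card
        := by
      refine Finset.card_bij' (fun b _ => ⟨fun j => b (Sum.inl j), fun j => b (Sum.inr j)⟩)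
        (fun p _ => Sum.elim p.1 p.2) ?_ ?_ ?_ ?_
      · intro b hb
        simpa using hb
      · intro p hp
        simpa using hp
      · intro b _
        ext x
        cases x <;> rfl
      · intro p _
        rfl
    rw [e1, Finset.card_sigma]
    have e2 : ∀ u : ι → Fin M → ZMod 2, (Fintype.piFinset fun _ : Fin k =>
        Finset.univ.filter fun x => x ∈ relativeCycles δ u).card ≤ 2 ^ ((M - L + 2 * t) * k) := by
      intro u
      rw [Fintype.card_piFinset, Finset.prod_const, Finset.card_fin, pow_mul]
      refine Nat.pow_le_pow_left ?_ k
      rw [← Fintype.card_subtype]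
      have := Module.card_eq_pow_finrank (K := ZMod 2) (V := relativeCycles δ u)
      rw [ZMod.card] at this
      refine (le_of_eq ?_).trans ((le_of_eq this).trans (Nat.pow_le_pow_right (by norm_num) ?_))
      · exact Fintype.card_congr (Equiv.refl _)
      · have := finrank_relativeCycles_le δ u
        omega
    calc _ ≤ ∑ u : ι → Fin M → ZMod 2, 2 ^ ((M - L + 2 * t) * k) := Finset.sum_le_sum fun u _ => e2 u
      _ = _ := by
        rw [Finset.sum_const, Finset.card_univ, smul_eq_mul]
        congr 1
        simp [ht, pow_mul]
  have key₀ := card_filter_mul_two_pow_le (boundaryOperators M H)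
    (fun g g' hg δ hδ => conj_mem_boundaryOperators hM hg hδ)
    (fun δ b => ∀ i, b (Sum.inr i) ∈ relativeCycles δ fun j => b (Sum.inl j))
    (fun g g' δ b hg hb i => mem_relativeCycles_conj hg (hb i)) h hN
  rw [Fintype.card_sum, Fintype.card_fin, ← ht] at key₀
  have key : ((boundaryOperators M H).filter fun δ => ∀ i, a i ∈ relativeCycles δ s).card *
      2 ^ ((M - 1) * (t + k)) ≤ (boundaryOperators M H).card *
        (2 ^ (M * t) * 2 ^ ((M - L + 2 * t) * k)) := key₀
  -- For `M = 0` the exponent `M - 1` truncates.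
  rcases Nat.eq_zero_or_pos M with h0 | h0
  · have hL : L = 0 := by omega
    rw [hL, Nat.zero_mul, pow_zero, mul_one]
    exact (Finset.card_filter_le _ _).trans (Nat.le_mul_of_pos_right _ (by positivity))
  · obtain ⟨m, hm⟩ : ∃ m, M = m + 1 := ⟨M - 1, by omega⟩
    obtain ⟨d, hd⟩ : ∃ d, M = L + d := ⟨L + H, by omega⟩
    have hsub : M - L = d := by omega
    have hsub' : M - 1 = m := by omega
    rw [hsub, hsub', ← pow_add] at key
    have hpos : 0 < 2 ^ (m * (t + k)) := by positivity
    refine Nat.le_of_mul_le_mul_right ?_ hpos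
    calc _ = (((boundaryOperators M H).filter fun δ => ∀ i, a i ∈ relativeCycles δ s).card *
          2 ^ (m * (t + k))) * 2 ^ (L * k) := by ring
      _ ≤ (boundaryOperators M H).card * 2 ^ (M * t + (d + 2 * t) * k) * 2 ^ (L * k) :=
          Nat.mul_le_mul_right _ key
      _ = _ := by
        rw [mul_assoc, mul_assoc, ← pow_add, ← pow_add]
        congr 2
        have e3 : L * k + d * k = (m + 1) * k := by rw [← add_mul, ← hd, hm]
        rw [hm]
        linarith

/-! ### Cycles of the product complex as matrices. -/

theorem productBoundary_mulVec {M : ℕ} (δ₁ δ₂ ψ : Matrix (Fin M) (Fin M) (ZMod 2)) :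
    ((productBoundary δ₁ δ₂).mulVec fun p => ψ p.1 p.2) =
      fun p => (δ₁ * ψ + ψ * δ₂.transpose) p.1 p.2 := by
  ext ⟨i, j⟩
  simp only [productBoundary, Matrix.mulVec, dotProduct, Matrix.add_apply,
    Matrix.kroneckerMap_apply, Matrix.mul_apply, Matrix.transpose_apply, add_mul,
    Finset.sum_add_distrib, Fintype.sum_prod_type]
  congr 1
  · refine Finset.sum_congr rfl fun x _ => ?_
    simp [Matrix.one_apply]
  · rw [Finset.sum_comm]
    refine Finset.sum_congr rfl fun x _ => ?_
    simp [Matrix.one_apply, mul_comm]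

theorem productBoundary_mulVec_eq_zero_iff {M : ℕ} (δ₁ δ₂ ψ : Matrix (Fin M) (Fin M) (ZMod 2)) :
    ((productBoundary δ₁ δ₂).mulVec fun p => ψ p.1 p.2) = 0 ↔ δ₁ * ψ = ψ * δ₂.transpose := by
  rw [productBoundary_mulVec, ← sub_eq_zero (b := ψ * δ₂.transpose), ZModModule.sub_eq_add]
  constructor
  · intro h
    ext i j
    exact congrFun h (i, j)
  · intro h
    rw [h]
    rfl

/-! ### The rank inequality after erasing rows and columns. -/

/-- An idempotent matrix with a prescribed kernel. -/
theorem exists_idempotent_ker_eq {M : ℕ} (W : Submodule (ZMod 2) (Fin M → ZMod 2)) :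
    ∃ P : Matrix (Fin M) (Fin M) (ZMod 2), P * P = P ∧ LinearMap.ker P.mulVecLin = W := by
  obtain ⟨U, hU⟩ := W.exists_isCompl
  refine ⟨LinearMap.toMatrix' (U.projection W hU.symm), ?_, ?_⟩
  · rw [← LinearMap.toMatrix'_mul]
    exact congrArg _ (Submodule.isIdempotentElem_projection hU.symm)
  · rw [← Matrix.toLin'_apply', Matrix.toLin'_toMatrix', Submodule.ker_projection]

/-- `x - P x` lies in `ker P`, which `δ` preserves. Thus `P * δ` represents the operator induced by
`δ` on the quotient by `ker P`. -/
theorem mul_mul_idempotent_eq {M : ℕ} {P δ : Matrix (Fin M) (Fin M) (ZMod 2)} (hP : P * P = P)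
    (h : ∀ x, P.mulVec x = 0 → P.mulVec (δ.mulVec x) = 0) : P * δ * P = P * δ := by
  refine Matrix.ext_of_mulVec_single fun i => ?_
  set x : Fin M → ZMod 2 := Pi.single i 1
  have h1 : P.mulVec (x - P.mulVec x) = 0 := by
    rw [Matrix.mulVec_sub, Matrix.mulVec_mulVec, hP, sub_self]
  have h2 := h _ h1
  rw [Matrix.mulVec_sub, Matrix.mulVec_sub, sub_eq_zero] at h2
  simp only [← Matrix.mulVec_mulVec]
  exact h2.symm

/-- If `δ` has square zero and preserves the range of `θ`, then `δ` at least halves its rank. -/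
theorem two_mul_rank_mul_le {M : ℕ} {δ δ' θ : Matrix (Fin M) (Fin M) (ZMod 2)} (h : δ * δ = 0)
    (hθ : δ * θ = θ * δ') : 2 * (δ * θ).rank ≤ θ.rank := by
  have h1 := finrank_map_add_finrank_inf_ker δ.mulVecLin (LinearMap.range θ.mulVecLin)
  have h2 : (LinearMap.range θ.mulVecLin).map δ.mulVecLin =
      LinearMap.range (δ * θ).mulVecLin := by
    rw [Matrix.mulVecLin_mul, LinearMap.range_comp]
  have h3 : LinearMap.range (δ * θ).mulVecLin ≤
      LinearMap.range θ.mulVecLin ⊓ LinearMap.ker δ.mulVecLin := by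
    refine le_inf ?_ ?_
    · rw [hθ, Matrix.mulVecLin_mul]
      exact LinearMap.range_comp_le_range _ _
    · rw [LinearMap.range_le_ker_iff, ← Matrix.mulVecLin_mul, ← Matrix.mul_assoc, h,
        Matrix.zero_mul, Matrix.mulVecLin_zero]
  have h4 := Submodule.finrank_mono h3
  rw [h2] at h1
  rw [Matrix.rank, Matrix.rank]
  omega

/-- The standard basis vectors indexed by `S`. -/
def basisVectors {M : ℕ} (S : Finset (Fin M)) (i : S) : Fin M → ZMod 2 := Pi.single (i : Fin M) 1

/-- The matrix obtained from `ψ` by erasing the rows in `S` and the columns in `T`. -/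
def eraseRowsCols {M : ℕ} (S T : Finset (Fin M)) (ψ : Matrix (Fin M) (Fin M) (ZMod 2)) :
    Matrix (Fin M) (Fin M) (ZMod 2) :=
  Matrix.of fun i j => if i ∈ S ∨ j ∈ T then 0 else ψ i j

theorem eraseRowsCols_transpose {M : ℕ} (S T : Finset (Fin M))
    (ψ : Matrix (Fin M) (Fin M) (ZMod 2)) :
    (eraseRowsCols S T ψ).transpose = eraseRowsCols T S ψ.transpose := by
  ext i j
  simp [eraseRowsCols, or_comm]

theorem col_eq_zero_of_basisVectors {M : ℕ} {S : Finset (Fin M)}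
    {P : Matrix (Fin M) (Fin M) (ZMod 2)} (h : ∀ i, P.mulVec (basisVectors S i) = 0) {j : Fin M}
    (hj : j ∈ S) (i : Fin M) : P i j = 0 := by
  have := congrFun (h ⟨j, hj⟩) i
  simpa [basisVectors] using this

theorem mul_eraseRowsCols_mul {M : ℕ} {S T : Finset (Fin M)}
    {P Q : Matrix (Fin M) (Fin M) (ZMod 2)} (hP : ∀ i, P.mulVec (basisVectors S i) = 0)
    (hQ : ∀ i, Q.mulVec (basisVectors T i) = 0) (ψ : Matrix (Fin M) (Fin M) (ZMod 2)) :
    P * eraseRowsCols S T ψ * Q.transpose = P * ψ * Q.transpose := by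
  ext i j
  simp only [Matrix.mul_apply, Finset.sum_mul, Matrix.transpose_apply]
  refine Finset.sum_congr rfl fun b _ => Finset.sum_congr rfl fun a _ => ?_
  by_cases ha : a ∈ S
  · simp [col_eq_zero_of_basisVectors hP ha]
  by_cases hb : b ∈ T
  · simp [col_eq_zero_of_basisVectors hQ hb]
  simp [eraseRowsCols, ha, hb]

theorem rank_mul_add_finrank_inf_ker {M : ℕ} (A B : Matrix (Fin M) (Fin M) (ZMod 2)) :
    (A * B).rank + Module.finrank (ZMod 2)
      (LinearMap.range B.mulVecLin ⊓ LinearMap.ker A.mulVecLin : Submodule _ _) = B.rank := by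
  rw [Matrix.rank, Matrix.mulVecLin_mul, LinearMap.range_comp]
  exact finrank_map_add_finrank_inf_ker _ _

/-- After erasing few rows and columns of a cycle of the product complex, either the column space or
the row space of the rest contains many relative cycles. -/
theorem rank_eraseRowsCols_le {M : ℕ} {δ₁ δ₂ ψ : Matrix (Fin M) (Fin M) (ZMod 2)}
    (h₁ : δ₁ * δ₁ = 0) (h₂ : δ₂ * δ₂ = 0) (hψ : δ₁ * ψ = ψ * δ₂.transpose) (S T : Finset (Fin M)) :
    (eraseRowsCols S T ψ).rank ≤
      2 * Module.finrank (ZMod 2) (LinearMap.range (eraseRowsCols S T ψ).mulVecLin ⊓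
        relativeCycles δ₁ (basisVectors S) : Submodule _ _) +
      Module.finrank (ZMod 2) (LinearMap.range (eraseRowsCols S T ψ).transpose.mulVecLin ⊓
        relativeCycles δ₂ (basisVectors T) : Submodule _ _) := by
  set φ := eraseRowsCols S T ψ with hφ
  -- `P` and `Q` model the quotients by the two generated subcomplexes. They kill `e_S` and `e_T`,
  -- so they do not distinguish `φ` from `ψ`, and `P * φ * Qᵀ` inherits the cycle equation.
  obtain ⟨P, hPP, hP⟩ := exists_idempotent_ker_eq (generatedSubcomplex δ₁ (basisVectors S))
  obtain ⟨Q, hQQ, hQ⟩ := exists_idempotent_ker_eq (generatedSubcomplex δ₂ (basisVectors T))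
  have hS : ∀ (δ : Matrix (Fin M) (Fin M) (ZMod 2)) (R : Matrix (Fin M) (Fin M) (ZMod 2))
      (U : Finset (Fin M)), LinearMap.ker R.mulVecLin = generatedSubcomplex δ (basisVectors U) →
      ∀ i, R.mulVec (basisVectors U i) = 0 := by
    intro δ R U hR i
    have : basisVectors U i ∈ LinearMap.ker R.mulVecLin := by
      rw [hR]
      exact Submodule.mem_sup_left (Submodule.subset_span ⟨i, rfl⟩)
    exact this
  have hinv : ∀ (δ : Matrix (Fin M) (Fin M) (ZMod 2)) (R : Matrix (Fin M) (Fin M) (ZMod 2))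
      (U : Finset (Fin M)), δ * δ = 0 → R * R = R →
      LinearMap.ker R.mulVecLin = generatedSubcomplex δ (basisVectors U) →
      R * δ * R = R * δ := by
    intro δ R U hδ hRR hR
    refine mul_mul_idempotent_eq hRR fun x hx => ?_
    have h1 : x ∈ LinearMap.ker R.mulVecLin := hx
    rw [hR] at h1
    have h2 : δ.mulVec x ∈ generatedSubcomplex δ (basisVectors U) :=
      generatedSubcomplex_le_relativeCycles hδ _ h1
    rw [← hR] at h2
    exact h2
  have hP' := hinv δ₁ P S h₁ hPP hP
  have hQ' := hinv δ₂ Q T h₂ hQQ hQ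
  have hθ : P * φ * Q.transpose = P * ψ * Q.transpose :=
    mul_eraseRowsCols_mul (hS _ _ _ hP) (hS _ _ _ hQ) ψ
  have hD : P * δ₁ * (P * δ₁) = 0 := by
    rw [← Matrix.mul_assoc, hP', Matrix.mul_assoc, h₁, Matrix.mul_zero]
  have hcomm : P * δ₁ * (P * φ * Q.transpose) = P * φ * Q.transpose * (δ₂.transpose * Q.transpose)
      := by
    have e1 : Q.transpose * (δ₂.transpose * Q.transpose) = δ₂.transpose * Q.transpose := by
      rw [← Matrix.transpose_mul, ← Matrix.transpose_mul, hQ']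
    calc P * δ₁ * (P * φ * Q.transpose) = P * δ₁ * P * ψ * Q.transpose := by
          rw [hθ]; simp only [Matrix.mul_assoc]
      _ = P * (δ₁ * ψ) * Q.transpose := by rw [hP']; simp only [Matrix.mul_assoc]
      _ = P * ψ * (δ₂.transpose * Q.transpose) := by rw [hψ]; simp only [Matrix.mul_assoc]
      _ = _ := by rw [hθ, Matrix.mul_assoc (P * ψ), e1]
  have h3 := two_mul_rank_mul_le hD hcomm
  have h4 : P * δ₁ * (P * φ * Q.transpose) = P * δ₁ * (φ * Q.transpose) := by
    calc _ = P * δ₁ * P * (φ * Q.transpose) := by simp only [Matrix.mul_assoc]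
      _ = _ := by rw [hP']
  have h5 : (P * φ * Q.transpose).rank ≤ (φ * Q.transpose).rank := by
    rw [Matrix.mul_assoc]
    exact Matrix.rank_mul_le_right _ _
  -- By halving, at least half of the range of `φ * Qᵀ` lies in `ker (P * δ₁)`, the relative cycles
  -- of `δ₁`: this is the coefficient 2. Passing from `φ` to `φ * Qᵀ` loses only the part of the row
  -- space in `ker Q`: this is the coefficient 1.
  have h6 := rank_mul_add_finrank_inf_ker (P * δ₁) (φ * Q.transpose)
  have h7 : (φ * Q.transpose).rank = (Q * φ.transpose).rank := by
    rw [← Matrix.rank_transpose, Matrix.transpose_mul, Matrix.transpose_transpose]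
  have h8 := rank_mul_add_finrank_inf_ker Q φ.transpose
  rw [Matrix.rank_transpose] at h8
  have h9 : Module.finrank (ZMod 2) (LinearMap.range (φ * Q.transpose).mulVecLin ⊓
      LinearMap.ker (P * δ₁).mulVecLin : Submodule _ _) ≤ Module.finrank (ZMod 2)
      (LinearMap.range φ.mulVecLin ⊓ relativeCycles δ₁ (basisVectors S) : Submodule _ _) := by
    refine Submodule.finrank_mono (inf_le_inf ?_ ?_)
    · rw [Matrix.mulVecLin_mul]
      exact LinearMap.range_comp_le_range _ _
    · rw [relativeCycles, ← hP, Matrix.mulVecLin_mul, LinearMap.ker_comp]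
  have h10 : Module.finrank (ZMod 2) (LinearMap.range φ.transpose.mulVecLin ⊓
      LinearMap.ker Q.mulVecLin : Submodule _ _) ≤ Module.finrank (ZMod 2)
      (LinearMap.range φ.transpose.mulVecLin ⊓ relativeCycles δ₂ (basisVectors T) :
        Submodule _ _) := by
    rw [hQ]
    exact Submodule.finrank_mono (inf_le_inf_left _ (generatedSubcomplex_le_relativeCycles h₂ _))
  rw [h4] at h3
  omega

/-! ### Homotopies that kill basis vectors. -/

/-- If `e_S` and `δ e_S` are independent, then the identity is homotopic to a chain map that
kills `e_S`. -/
theorem exists_homotopy {M : ℕ} {δ : Matrix (Fin M) (Fin M) (ZMod 2)}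
    {S : Finset (Fin M)} (h : LinearIndependent (ZMod 2)
      (Sum.elim (basisVectors S) fun i => δ.mulVec (basisVectors S i))) :
    ∃ K : Matrix (Fin M) (Fin M) (ZMod 2),
      ∀ i, (1 + δ * K + K * δ).mulVec (basisVectors S i) = 0 := by
  -- `K` sends `e_i` to `0` and `δ e_i` to `e_i`, extended arbitrarily; then `(1 + δ K + K δ) e_i =
  -- e_i + e_i = 0`.
  let b := Module.Basis.span h
  obtain ⟨f, hf⟩ := LinearMap.exists_extend
    (b.constr (ZMod 2) (Sum.elim (fun _ => (0 : Fin M → ZMod 2)) (basisVectors S)))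
  have hfb : ∀ x, f (Sum.elim (basisVectors S) (fun i => δ.mulVec (basisVectors S i)) x) =
      Sum.elim (fun _ => (0 : Fin M → ZMod 2)) (basisVectors S) x := by
    intro x
    have h1 := LinearMap.congr_fun hf (b x)
    rw [Module.Basis.constr_basis, LinearMap.comp_apply, Submodule.subtype_apply,
      Module.Basis.span_apply] at h1
    exact h1
  refine ⟨LinearMap.toMatrix' f, fun i => ?_⟩
  have h1 : (LinearMap.toMatrix' f).mulVec (basisVectors S i) = 0 := by
    rw [LinearMap.toMatrix'_mulVec]
    exact hfb (Sum.inl i)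
  have h2 : (LinearMap.toMatrix' f).mulVec (δ.mulVec (basisVectors S i)) = basisVectors S i := by
    rw [LinearMap.toMatrix'_mulVec]
    exact hfb (Sum.inr i)
  rw [Matrix.add_mulVec, Matrix.add_mulVec, ← Matrix.mulVec_mulVec, ← Matrix.mulVec_mulVec, h1, h2,
    Matrix.mulVec_zero, Matrix.one_mulVec, add_zero, ZModModule.add_self]

/-- A cycle of the product complex that is supported on rows `S` and columns `T` is trivial. -/
theorem exists_boundary_of_eraseRowsCols_eq_zero {M : ℕ}
    {δ₁ δ₂ ψ : Matrix (Fin M) (Fin M) (ZMod 2)} (h₁ : δ₁ * δ₁ = 0)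
    (hψ : δ₁ * ψ = ψ * δ₂.transpose) {S T : Finset (Fin M)}
    (hS : LinearIndependent (ZMod 2)
      (Sum.elim (basisVectors S) fun i => δ₁.mulVec (basisVectors S i)))
    (hT : LinearIndependent (ZMod 2)
      (Sum.elim (basisVectors T) fun i => δ₂.mulVec (basisVectors T i)))
    (h : eraseRowsCols S T ψ = 0) :
    ∃ ξ : Matrix (Fin M) (Fin M) (ZMod 2), δ₁ * ξ + ξ * δ₂.transpose = ψ := by
  obtain ⟨K₁, hK₁⟩ := exists_homotopy hS
  obtain ⟨K₂, hK₂⟩ := exists_homotopy hT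
  have h0 := mul_eraseRowsCols_mul hK₁ hK₂ ψ
  rw [h, Matrix.mul_zero, Matrix.zero_mul] at h0
  set P := 1 + δ₁ * K₁ + K₁ * δ₁ with hP
  have hPδ : δ₁ * P = P * δ₁ := by
    rw [hP]
    simp only [mul_add, add_mul, mul_one, one_mul, ← mul_assoc, h₁, zero_mul]
    simp only [mul_assoc, h₁, mul_zero, add_zero]
  have hcyc : δ₁ * (P * ψ) = P * ψ * δ₂.transpose := by
    rw [← mul_assoc, hPδ, mul_assoc, hψ, mul_assoc]
  -- `P * ψ` is homologous to `ψ`. In the same way it is homologous to its product with the second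
  -- homotopic map, which vanishes by `h0`.
  have e1 : P * ψ = ψ + (δ₁ * (K₁ * ψ) + K₁ * ψ * δ₂.transpose) := by
    rw [hP, mul_assoc K₁ ψ, ← hψ]
    simp only [add_mul, one_mul, mul_assoc, add_assoc]
  set χ := P * ψ with hχ
  have e2 : χ * (1 + δ₂ * K₂ + K₂ * δ₂).transpose =
      χ + (δ₁ * (χ * K₂.transpose) + χ * K₂.transpose * δ₂.transpose) := by
    rw [← mul_assoc δ₁, hcyc]
    simp only [Matrix.transpose_add, Matrix.transpose_mul, Matrix.transpose_one, mul_add, mul_one,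
      mul_assoc, add_assoc]
    rw [add_comm (χ * (K₂.transpose * δ₂.transpose))]
  rw [e2] at h0
  refine ⟨K₁ * ψ + χ * K₂.transpose, ?_⟩
  have e3 : ψ = χ + (δ₁ * (K₁ * ψ) + K₁ * ψ * δ₂.transpose) := by
    rw [e1, add_assoc, ZModModule.add_self, add_zero]
  have e4 := sub_eq_zero.mp ((ZModModule.sub_eq_add _ _).trans h0.symm)
  conv_rhs => rw [e3, e4]
  simp only [mul_add, add_mul]
  abel

/-! ### Light cycles of small rank. -/

/-- Few combinations of light vectors are cycles of `δ`, even relative to a small subcomplex. -/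
def HasFewLightCycles {M : ℕ} (δ : Matrix (Fin M) (Fin M) (ZMod 2)) (w R : ℕ) : Prop :=
  ∀ T : Finset (Fin M), T.card ≤ w → ∀ s : Set (Fin M → ZMod 2),
    (∀ x ∈ s, hammingNorm x ≤ w ∧ ∀ i ∈ T, x i = 0) →
    0 < Module.finrank (ZMod 2) (Submodule.span (ZMod 2) s) →
    Module.finrank (ZMod 2) (Submodule.span (ZMod 2) s) ≤ R →
    3 * Module.finrank (ZMod 2)
      (Submodule.span (ZMod 2) s ⊓ relativeCycles δ (basisVectors T) : Submodule _ _) <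
      Module.finrank (ZMod 2) (Submodule.span (ZMod 2) s)

/-- The case `T = ∅`, `s = {x}`: a nonzero light cycle would span a line made of relative cycles,
giving `3 < 1`. -/
theorem HasFewLightCycles.eq_zero_of_mulVec_eq_zero {M w R : ℕ}
    {δ : Matrix (Fin M) (Fin M) (ZMod 2)} (h : HasFewLightCycles δ w R) (hR : 1 ≤ R)
    {x : Fin M → ZMod 2} (hx : hammingNorm x ≤ w) (hδ : δ.mulVec x = 0) : x = 0 := by
  by_contra h0
  have h1 := finrank_span_singleton (K := ZMod 2) h0
  have h2 := h ∅ (by simp) {x} (by simpa using hx) (by omega) (by omega)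
  rw [inf_of_le_left, h1] at h2
  · omega
  · rw [Submodule.span_singleton_le_iff_mem, relativeCycles, Submodule.mem_comap,
      Matrix.mulVecLin_apply, hδ]
    exact Submodule.zero_mem _

theorem linearIndependent_basisVectors {M : ℕ} (S : Finset (Fin M)) :
    LinearIndependent (ZMod 2) (basisVectors S) := by
  have h := (Pi.basisFun (ZMod 2) (Fin M)).linearIndependent.comp ((↑) : S → Fin M)
    Subtype.val_injective
  convert h using 1
  ext i
  simp [basisVectors]

theorem sum_smul_basisVectors_apply_eq_zero {M : ℕ} {S : Finset (Fin M)} (c : S → ZMod 2)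
    {i : Fin M} (hi : i ∉ S) : (∑ j, c j • basisVectors S j) i = 0 := by
  rw [Finset.sum_apply]
  refine Finset.sum_eq_zero fun j _ => ?_
  have : i ≠ j := fun h => hi (h ▸ j.2)
  simp [basisVectors, this]

theorem hammingNorm_sum_smul_basisVectors_le {M : ℕ} {S : Finset (Fin M)} (c : S → ZMod 2) :
    hammingNorm (∑ j, c j • basisVectors S j) ≤ S.card := by
  refine Finset.card_le_card fun i hi => ?_
  by_contra h
  exact (Finset.mem_filter.mp hi).2 (sum_smul_basisVectors_apply_eq_zero c h)

/-- Apply `δ` to a relation `a + δ b = 0` with `a`, `b` supported on `S`: `a` is a light cycle,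
hence zero, and then so is `b`. This supplies the hypothesis of `exists_homotopy`. -/
theorem HasFewLightCycles.linearIndependent {M w R : ℕ} {δ : Matrix (Fin M) (Fin M) (ZMod 2)}
    (h : HasFewLightCycles δ w R) (hR : 1 ≤ R) (hδ : δ * δ = 0) {S : Finset (Fin M)}
    (hS : S.card ≤ w) : LinearIndependent (ZMod 2)
      (Sum.elim (basisVectors S) fun i => δ.mulVec (basisVectors S i)) := by
  rw [Fintype.linearIndependent_iff]
  intro g hg
  rw [Fintype.sum_sum_type] at hg
  simp only [Sum.elim_inl, Sum.elim_inr] at hg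
  set a := ∑ j, g (Sum.inl j) • basisVectors S j with ha
  set b := ∑ j, g (Sum.inr j) • basisVectors S j with hb
  have hb' : ∑ j, g (Sum.inr j) • δ.mulVec (basisVectors S j) = δ.mulVec b := by
    rw [hb, Matrix.mulVec_sum]
    exact Finset.sum_congr rfl fun j _ => (Matrix.mulVec_smul _ _ _).symm
  rw [hb'] at hg
  have ha0 : a = 0 := by
    refine h.eq_zero_of_mulVec_eq_zero hR ((hammingNorm_sum_smul_basisVectors_le _).trans hS) ?_
    have := congrArg δ.mulVec hg
    rwa [Matrix.mulVec_add, Matrix.mulVec_mulVec, hδ, Matrix.zero_mulVec, add_zero,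
      Matrix.mulVec_zero] at this
  rw [ha0, zero_add] at hg
  have hb0 : b = 0 :=
    h.eq_zero_of_mulVec_eq_zero hR ((hammingNorm_sum_smul_basisVectors_le _).trans hS) hg
  have hind := Fintype.linearIndependent_iff.mp (linearIndependent_basisVectors S)
  rintro (i | i)
  · exact hind _ ha0 i
  · exact hind _ hb0 i

theorem rank_eraseRowsCols_le_rank {M : ℕ} (S T : Finset (Fin M))
    (ψ : Matrix (Fin M) (Fin M) (ZMod 2)) : (eraseRowsCols S T ψ).rank ≤ ψ.rank := by
  have : eraseRowsCols S T ψ = Matrix.diagonal (fun i => if i ∈ S then 0 else 1) * ψ *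
      Matrix.diagonal (fun i => if i ∈ T then 0 else 1) := by
    ext i j
    by_cases hi : i ∈ S <;> by_cases hj : j ∈ T <;>
      simp [eraseRowsCols, Matrix.diagonal_mul, Matrix.mul_diagonal, hi, hj]
  rw [this]
  exact (Matrix.rank_mul_le_left _ _).trans (Matrix.rank_mul_le_right _ _)

/-- The column space of the erased matrix is spanned by its columns, which are light and vanish on
`S`. -/
theorem HasFewLightCycles.three_mul_finrank_lt {M w R : ℕ} {δ ψ : Matrix (Fin M) (Fin M) (ZMod 2)}
    (h : HasFewLightCycles δ w R) {S T : Finset (Fin M)} (hS : S.card ≤ w)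
    (hT : ∀ j, j ∉ T → hammingNorm (ψ.transpose j) ≤ w) (h0 : 0 < (eraseRowsCols S T ψ).rank)
    (hR : ψ.rank ≤ R) :
    3 * Module.finrank (ZMod 2) (LinearMap.range (eraseRowsCols S T ψ).mulVecLin ⊓
        relativeCycles δ (basisVectors S) : Submodule _ _) < (eraseRowsCols S T ψ).rank := by
  have hR' := (rank_eraseRowsCols_le_rank S T ψ).trans hR
  rw [Matrix.rank] at h0 hR' ⊢
  rw [Matrix.range_mulVecLin] at h0 hR' ⊢
  refine h S hS _ ?_ h0 hR'
  rintro _ ⟨j, rfl⟩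
  constructor
  · by_cases hj : j ∈ T
    · have : (eraseRowsCols S T ψ).col j = 0 := by
        ext i
        simp [eraseRowsCols, Matrix.col, hj]
      rw [this, hammingNorm_zero]
      exact Nat.zero_le _
    · refine le_trans (Finset.card_le_card fun i hi => ?_) (hT j hj)
      rw [Finset.mem_filter] at hi ⊢
      refine ⟨hi.1, fun h1 => hi.2 ?_⟩
      have : ψ i j = 0 := h1
      simp [eraseRowsCols, Matrix.col, this]
  · intro i hi
    simp [eraseRowsCols, Matrix.col, hi]

/-- A cycle of small rank in the product complex that is light outside few rows and columns is
trivial. -/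
theorem exists_boundary_of_rank_le {M w R : ℕ} {δ₁ δ₂ ψ : Matrix (Fin M) (Fin M) (ZMod 2)}
    (h₁ : δ₁ * δ₁ = 0) (h₂ : δ₂ * δ₂ = 0) (hf₁ : HasFewLightCycles δ₁ w R)
    (hf₂ : HasFewLightCycles δ₂ w R) (hR : 1 ≤ R) (hψ : δ₁ * ψ = ψ * δ₂.transpose)
    (hrank : ψ.rank ≤ R) {S T : Finset (Fin M)} (hSc : S.card ≤ w) (hTc : T.card ≤ w)
    (hS : ∀ i, i ∉ S → hammingNorm (ψ i) ≤ w)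
    (hT : ∀ j, j ∉ T → hammingNorm (ψ.transpose j) ≤ w) :
    ∃ ξ : Matrix (Fin M) (Fin M) (ZMod 2), δ₁ * ξ + ξ * δ₂.transpose = ψ := by
  rcases Nat.eq_zero_or_pos (eraseRowsCols S T ψ).rank with h0 | h0
  · refine exists_boundary_of_eraseRowsCols_eq_zero h₁ hψ (hf₁.linearIndependent hR h₁ hSc)
      (hf₂.linearIndependent hR h₂ hTc) ?_
    have h3 := LinearMap.range_eq_bot.mp (Submodule.finrank_eq_zero.mp h0)
    exact Matrix.toLin'.injective (h3.trans (map_zero _).symm)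
  · exfalso
    have e1 := rank_eraseRowsCols_le h₁ h₂ hψ S T
    have e2 := hf₁.three_mul_finrank_lt hSc hT h0 hrank
    have e3 := hf₂.three_mul_finrank_lt (ψ := ψ.transpose) (T := S) hTc hS
      (by rwa [← eraseRowsCols_transpose, Matrix.rank_transpose]) (by rwa [Matrix.rank_transpose])
    rw [← eraseRowsCols_transpose, Matrix.rank_transpose] at e3
    omega

/-! ### Equations satisfied by a random boundary operator. -/

/-- A fixed matrix of rank more than `R` is unlikely to satisfy a fixed equation `δ * ψ = Y`. -/
theorem card_mul_eq_mul_le {M L H : ℕ} (hM : M = 2 * L + H)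
    {ψ Y : Matrix (Fin M) (Fin M) (ZMod 2)} [DecidablePred fun δ => δ * ψ = Y]
    {k : ℕ} (hk : 2 * k ≤ ψ.rank + 1) :
    ((boundaryOperators M H).filter fun δ => δ * ψ = Y).card * 2 ^ (L * k) ≤
      (boundaryOperators M H).card * 2 ^ k := by
  classical
  -- If `δ * ψ = Y`, then `δ` kills both `ψ (ker Y)` and, since `δ * δ = 0`, the range of `Y`. Their
  -- dimensions add up to at least `rank ψ ≥ 2 * k - 1`, so one of them is at least `k`. Neither
  -- space depends on `δ`.
  set U := (LinearMap.ker Y.mulVecLin).map ψ.mulVecLin with hU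
  have h1 := finrank_map_add_finrank_inf_ker ψ.mulVecLin (LinearMap.ker Y.mulVecLin)
  rw [← hU] at h1
  have h2 := Y.mulVecLin.finrank_range_add_finrank_ker
  have h3 := ψ.mulVecLin.finrank_range_add_finrank_ker
  have h4 := Submodule.finrank_mono
    (inf_le_right : LinearMap.ker Y.mulVecLin ⊓ LinearMap.ker ψ.mulVecLin ≤ _)
  rw [Matrix.rank] at hk
  obtain ⟨W, hkW, hW⟩ : ∃ W : Submodule (ZMod 2) (Fin M → ZMod 2), k ≤ Module.finrank (ZMod 2) W ∧
      ∀ δ ∈ boundaryOperators M H, δ * ψ = Y → W ≤ LinearMap.ker δ.mulVecLin := by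
    by_cases hc : k ≤ Module.finrank (ZMod 2) U
    · refine ⟨U, hc, fun δ _ h => ?_⟩
      rw [hU, Submodule.map_le_iff_le_comap, ← LinearMap.ker_comp, ← Matrix.mulVecLin_mul, h]
    · refine ⟨LinearMap.range Y.mulVecLin, by omega, fun δ hδ h => ?_⟩
      rw [LinearMap.range_le_ker_iff, ← Matrix.mulVecLin_mul, ← h, ← Matrix.mul_assoc,
        ((mem_boundaryOperators hM).mp hδ).1, Matrix.zero_mul, Matrix.mulVecLin_zero]
  let b := Module.finBasis (ZMod 2) W
  let a : Fin k → Fin M → ZMod 2 := fun i => b (Fin.castLE hkW i)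
  have ha : LinearIndependent (ZMod 2) a :=
    (b.linearIndependent.map' W.subtype W.ker_subtype).comp _ (Fin.castLE_injective hkW)
  -- Relative to the empty family, relative cycles are cycles.
  have ha' : LinearIndependent (ZMod 2) (Sum.elim (Empty.elim : Empty → Fin M → ZMod 2) a) :=
    (linearIndependent_equiv (Equiv.emptySum Empty (Fin k)).symm).mp ha
  have key := card_relativeCycles_mul_le hM ha'
  simp only [Fintype.card_empty, Nat.mul_zero, Nat.add_zero, Nat.mul_one, Nat.zero_add] at key
  refine le_trans (Nat.mul_le_mul_right _ (Finset.card_le_card fun δ hδ => ?_)) key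
  rw [Finset.mem_filter] at hδ ⊢
  refine ⟨hδ.1, fun i => ?_⟩
  have : δ.mulVecLin (a i) = 0 := hW δ hδ.1 hδ.2 (b (Fin.castLE hkW i)).2
  rw [relativeCycles, Submodule.mem_comap, this]
  exact Submodule.zero_mem _

/-! ### Union bound for light relative cycles. -/

theorem card_le_sum_card_filter {α β : Type*} {t s : Finset α} {I : Finset β}
    {P : α → β → Prop} [∀ p, DecidablePred fun x => P x p]
    (h : ∀ x ∈ t, x ∈ s ∧ ∃ p ∈ I, P x p) :
    t.card ≤ ∑ p ∈ I, (s.filter fun x => P x p).card := by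
  classical
  refine le_trans (Finset.card_le_card ?_) Finset.card_biUnion_le
  intro x hx
  obtain ⟨hx, p, hp, h⟩ := h x hx
  exact Finset.mem_biUnion.mpr ⟨p, hp, Finset.mem_filter.mpr ⟨hx, h⟩⟩

theorem linearIndependent_sumElim_basisVectors {M k : ℕ} {T : Finset (Fin M)}
    {a : Fin k → Fin M → ZMod 2} (ha : LinearIndependent (ZMod 2) a)
    (haT : ∀ i, ∀ j ∈ T, a i j = 0) :
    LinearIndependent (ZMod 2) (Sum.elim (basisVectors T) a) := by
  rw [Fintype.linearIndependent_iff]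
  intro g hg
  rw [Fintype.sum_sum_type] at hg
  simp only [Sum.elim_inl, Sum.elim_inr] at hg
  have hl : ∀ j : T, g (Sum.inl j) = 0 := by
    intro j
    have h1 := congrFun hg j
    rw [Pi.add_apply, Finset.sum_apply, Finset.sum_apply, Finset.sum_eq_single j,
      Finset.sum_eq_zero] at h1
    · simpa [basisVectors] using h1
    · intro i _
      simp [haT i j j.2]
    · intro i _ hij
      have : (j : Fin M) ≠ i := fun h => hij (Subtype.ext h.symm)
      simp [basisVectors, this]
    · simp
  rintro (j | i)
  · exact hl j
  · simp only [hl, zero_smul, Finset.sum_const_zero, zero_add] at hg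
    exact Fintype.linearIndependent_iff.mp ha _ hg i

-- Union bound over `T` (`2 ^ v` choices), the light vectors `B` (`2 ^ (v * r)`) and the
-- coefficients of `a` in `B` (`2 ^ (r * k)`); the remaining exponent comes from
-- `card_relativeCycles_mul_le`.
open Classical in
theorem card_span_relativeCycles_mul_le {M L H : ℕ} (hM : M = 2 * L + H) {w v : ℕ} (r k : ℕ)
    (hv : ((Finset.univ : Finset (Finset (Fin M))).filter fun T => T.card ≤ w).card ≤ 2 ^ v) :
    ((boundaryOperators M H).filter fun δ => ∃ T : Finset (Fin M), T.card ≤ w ∧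
      ∃ B : Fin r → Fin M → ZMod 2, (∀ j, hammingNorm (B j) ≤ w) ∧
      ∃ a : Fin k → Fin M → ZMod 2, LinearIndependent (ZMod 2) (Sum.elim (basisVectors T) a) ∧
        ∀ i, a i ∈ Submodule.span (ZMod 2) (Set.range B) ∧
          a i ∈ relativeCycles δ (basisVectors T)).card * 2 ^ (L * k) ≤
      (boundaryOperators M H).card * 2 ^ (v + v * r + r * k + w + k * (1 + 2 * w)) := by
  set Ω := boundaryOperators M H with hΩ
  let 𝒯 := (Finset.univ : Finset (Finset (Fin M))).filter fun T => T.card ≤ w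
  let ℬ := Fintype.piFinset fun _ : Fin r =>
    (Finset.univ : Finset (Fin M → ZMod 2)).filter fun x => hammingNorm x ≤ w
  let 𝒞 := (Finset.univ : Finset (Fin k → Fin r → ZMod 2))
  let fam : (Fin r → Fin M → ZMod 2) → (Fin k → Fin r → ZMod 2) → Fin k → Fin M → ZMod 2 :=
    fun B C i => ∑ j, C i j • B j
  let I := (𝒯 ×ˢ ℬ ×ˢ 𝒞).filter fun p =>
    LinearIndependent (ZMod 2) (Sum.elim (basisVectors p.1) (fam p.2.1 p.2.2))
  have hI : I.card ≤ 2 ^ (v + v * r + r * k) := by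
    refine (Finset.card_filter_le _ _).trans ?_
    rw [Finset.card_product, Finset.card_product, pow_add, pow_add, mul_assoc]
    refine Nat.mul_le_mul hv (Nat.mul_le_mul ?_ ?_)
    · rw [Fintype.card_piFinset, Finset.prod_const, Finset.card_fin, pow_mul]
      exact Nat.pow_le_pow_left ((card_hammingNorm_le (· ≤ w)).trans hv) r
    · simp [𝒞, pow_mul]
  have hsub : ∀ δ ∈ Ω.filter (fun δ => ∃ T : Finset (Fin M), T.card ≤ w ∧
      ∃ B : Fin r → Fin M → ZMod 2, (∀ j, hammingNorm (B j) ≤ w) ∧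
      ∃ a : Fin k → Fin M → ZMod 2, LinearIndependent (ZMod 2) (Sum.elim (basisVectors T) a) ∧
        ∀ i, a i ∈ Submodule.span (ZMod 2) (Set.range B) ∧
          a i ∈ relativeCycles δ (basisVectors T)),
      δ ∈ Ω ∧ ∃ p ∈ I, ∀ i, fam p.2.1 p.2.2 i ∈ relativeCycles δ (basisVectors p.1) := by
    intro δ hδ
    rw [Finset.mem_filter] at hδ
    obtain ⟨hδ, T, hT, B, hB, a, ha, haB⟩ := hδ
    choose C hC using fun i => (Submodule.mem_span_range_iff_exists_fun (ZMod 2)).mp (haB i).1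
    have hfam : fam B C = a := funext hC
    refine ⟨hδ, (T, B, C), ?_, fun i => ?_⟩
    · simp only [I, 𝒯, ℬ, 𝒞, Finset.mem_filter, Finset.mem_product, Fintype.mem_piFinset,
        Finset.mem_univ, true_and, and_true]
      exact ⟨⟨hT, hB⟩, by rwa [hfam]⟩
    · change fam B C i ∈ _
      rw [hfam]
      exact (haB i).2
  have hterm : ∀ p ∈ I, (Ω.filter fun δ =>
      ∀ i, fam p.2.1 p.2.2 i ∈ relativeCycles δ (basisVectors p.1)).card * 2 ^ (L * k) ≤
      Ω.card * 2 ^ (w + k * (1 + 2 * w)) := by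
    intro p hp
    rw [Finset.mem_filter, Finset.mem_product] at hp
    have ht : p.1.card ≤ w := (Finset.mem_filter.mp hp.1.1).2
    refine (card_relativeCycles_mul_le hM hp.2).trans (Nat.mul_le_mul_left _ ?_)
    rw [Fintype.card_coe]
    refine Nat.pow_le_pow_right (by norm_num) ?_
    gcongr
  calc _ ≤ (∑ p ∈ I, (Ω.filter fun δ =>
        ∀ i, fam p.2.1 p.2.2 i ∈ relativeCycles δ (basisVectors p.1)).card) * 2 ^ (L * k) := by
        exact Nat.mul_le_mul_right _ (card_le_sum_card_filter hsub)
    _ ≤ ∑ p ∈ I, Ω.card * 2 ^ (w + k * (1 + 2 * w)) := by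
        rw [Finset.sum_mul]
        exact Finset.sum_le_sum hterm
    _ = I.card * (Ω.card * 2 ^ (w + k * (1 + 2 * w))) := by rw [Finset.sum_const, smul_eq_mul]
    _ ≤ 2 ^ (v + v * r + r * k) * (Ω.card * 2 ^ (w + k * (1 + 2 * w))) :=
        Nat.mul_le_mul_right _ hI
    _ = _ := by rw [add_assoc (v + v * r + r * k), pow_add _ (v + v * r + r * k)]; ring

open Classical in
/-- Few boundary operators have many light relative cycles. -/
theorem card_not_hasFewLightCycles_mul_le {M L H : ℕ} (hM : M = 2 * L + H) {w v R u : ℕ}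
    (hv : ((Finset.univ : Finset (Finset (Fin M))).filter fun T => T.card ≤ w).card ≤ 2 ^ v)
    (hL : 4 * v + R + 3 * w + 1 + u ≤ L) :
    ((boundaryOperators M H).filter fun δ => ¬ HasFewLightCycles δ w R).card * 2 ^ u ≤
      R * (boundaryOperators M H).card := by
  set Ω := boundaryOperators M H with hΩ
  let P : Matrix (Fin M) (Fin M) (ZMod 2) → ℕ → Prop := fun δ r =>
    ∃ T : Finset (Fin M), T.card ≤ w ∧
      ∃ B : Fin r → Fin M → ZMod 2, (∀ j, hammingNorm (B j) ≤ w) ∧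
      ∃ a : Fin ((r + 2) / 3) → Fin M → ZMod 2,
        LinearIndependent (ZMod 2) (Sum.elim (basisVectors T) a) ∧
        ∀ i, a i ∈ Submodule.span (ZMod 2) (Set.range B) ∧ a i ∈ relativeCycles δ (basisVectors T)
  have hsub : ∀ δ ∈ Ω.filter (fun δ => ¬ HasFewLightCycles δ w R),
      δ ∈ Ω ∧ ∃ r ∈ Finset.Icc 1 R, P δ r := by
    intro δ hδ
    rw [Finset.mem_filter] at hδ
    refine ⟨hδ.1, ?_⟩
    have h := hδ.2
    unfold HasFewLightCycles at h
    push Not at h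
    obtain ⟨T, hT, s, hs, h0, hR, h3⟩ := h
    -- The basis is taken from `s` itself, so that its vectors stay light.
    obtain ⟨B, hBs, hB, -⟩ := Submodule.exists_fun_fin_finrank_span_eq (ZMod 2) s
    refine ⟨_, Finset.mem_Icc.mpr ⟨h0, hR⟩, T, hT, B, fun j => (hs _ (hBs j)).1, ?_⟩
    set W := Submodule.span (ZMod 2) s ⊓ relativeCycles δ (basisVectors T)
    have hk : (Module.finrank (ZMod 2) (Submodule.span (ZMod 2) s) + 2) / 3 ≤
        Module.finrank (ZMod 2) W := by omega
    let b := Module.finBasis (ZMod 2) W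
    have hvan : ∀ x ∈ Submodule.span (ZMod 2) s, ∀ i ∈ T, x i = 0 := by
      intro x hx i hi
      induction hx using Submodule.span_induction with
      | mem x hx => exact (hs x hx).2 i hi
      | zero => rfl
      | add x y _ _ h1 h2 => rw [Pi.add_apply, h1, h2, add_zero]
      | smul c x _ h1 => rw [Pi.smul_apply, h1, smul_zero]
    refine ⟨fun i => b (Fin.castLE hk i), linearIndependent_sumElim_basisVectors
      ((b.linearIndependent.map' W.subtype W.ker_subtype).comp _ (Fin.castLE_injective hk))
      (fun i => hvan _ (b (Fin.castLE hk i)).2.1), fun i => ?_⟩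
    rw [hB]
    exact (b (Fin.castLE hk i)).2
  have hterm : ∀ r ∈ Finset.Icc 1 R, (Ω.filter fun δ => P δ r).card * 2 ^ u ≤ Ω.card := by
    intro r hr
    rw [Finset.mem_Icc] at hr
    set k := (r + 2) / 3 with hk
    have hk1 : 1 ≤ k := by omega
    -- With `k = ⌈r / 3⌉` every term of the exponent is at most a multiple of `k`, so `hL` suffices
    -- for all `r ≤ R`; the choices of `T` and `B` together account for `4 * v`.
    have hrk : 1 + r ≤ 4 * k := by omega
    have key := card_span_relativeCycles_mul_le hM r k hv
    set E := v + v * r + r * k + w + k * (1 + 2 * w) with hE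
    have hEL : E + u ≤ L * k := by
      have e1 : v * (1 + r) ≤ v * (4 * k) := Nat.mul_le_mul_left _ hrk
      have e2 : r * k ≤ R * k := Nat.mul_le_mul_right _ hr.2
      have e3 : w * 1 ≤ w * k := Nat.mul_le_mul_left _ hk1
      have e4 : u * 1 ≤ u * k := Nat.mul_le_mul_left _ hk1
      have e5 := Nat.mul_le_mul_right k hL
      rw [hE]
      linarith
    refine Nat.le_of_mul_le_mul_right ?_ (show 0 < 2 ^ E by positivity)
    refine le_trans ?_ key
    rw [mul_assoc, ← pow_add, add_comm u]
    exact Nat.mul_le_mul_left _ (Nat.pow_le_pow_right (by norm_num) hEL)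
  calc _ ≤ (∑ r ∈ Finset.Icc 1 R, (Ω.filter fun δ => P δ r).card) * 2 ^ u :=
        Nat.mul_le_mul_right _ (card_le_sum_card_filter hsub)
    _ ≤ ∑ r ∈ Finset.Icc 1 R, Ω.card := by
        rw [Finset.sum_mul]
        exact Finset.sum_le_sum hterm
    _ = R * Ω.card := by simp

/-! ### Counting product complexes with a light nontrivial cycle. -/

theorem sum_hammingNorm_row {M : ℕ} (ψ : Matrix (Fin M) (Fin M) (ZMod 2)) :
    ∑ i, hammingNorm (ψ i) = hammingNorm fun p : Fin M × Fin M => ψ p.1 p.2 := by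
  simp only [hammingNorm, Finset.card_filter]
  rw [Fintype.sum_prod_type]

theorem sum_hammingNorm_col {M : ℕ} (ψ : Matrix (Fin M) (Fin M) (ZMod 2)) :
    ∑ j, hammingNorm (ψ.transpose j) = hammingNorm fun p : Fin M × Fin M => ψ p.1 p.2 := by
  simp only [hammingNorm, Finset.card_filter]
  rw [Fintype.sum_prod_type_right]
  rfl

/-- A matrix of weight less than `(w + 1) ^ 2` has at most `w` rows of weight more than `w`. -/
theorem card_heavy_le {M w D : ℕ} (hD : D < (w + 1) * (w + 1)) {f : Fin M → ℕ}
    (hf : ∑ i, f i ≤ D) : (Finset.univ.filter fun i => w < f i).card ≤ w := by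
  by_contra! h
  have h1 : (Finset.univ.filter fun i => w < f i).card * (w + 1) ≤
      ∑ i ∈ Finset.univ.filter fun i => w < f i, f i := by
    rw [← smul_eq_mul, ← Finset.sum_const]
    exact Finset.sum_le_sum fun i hi => (Finset.mem_filter.mp hi).2
  have h2 : ∑ i ∈ Finset.univ.filter (fun i => w < f i), f i ≤ ∑ i, f i :=
    Finset.sum_le_sum_of_subset (Finset.filter_subset _ _)
  have h3 : (w + 1) * (w + 1) ≤ (Finset.univ.filter fun i => w < f i).card * (w + 1) :=
    Nat.mul_le_mul_right _ h
  omega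

/-- `x` is a nontrivial cycle of weight at most `D`. -/
def IsLightNontrivialCycle {n : Type*} [Fintype n] (δ : Matrix n n (ZMod 2)) (D : ℕ)
    (x : n → ZMod 2) : Prop :=
  x ∈ cycles δ ∧ x ∉ trivialCycles δ ∧ hammingNorm x ≤ D

/-- Light nontrivial cycles of the product complex have large rank. -/
theorem lt_rank_of_isLightNontrivialCycle {M w R D : ℕ} {δ₁ δ₂ : Matrix (Fin M) (Fin M) (ZMod 2)}
    (h₁ : δ₁ * δ₁ = 0) (h₂ : δ₂ * δ₂ = 0) (hf₁ : HasFewLightCycles δ₁ w R)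
    (hf₂ : HasFewLightCycles δ₂ w R) (hR : 1 ≤ R) (hD : D < (w + 1) * (w + 1))
    {ψ : Matrix (Fin M) (Fin M) (ZMod 2)}
    (hψ : IsLightNontrivialCycle (productBoundary δ₁ δ₂) D fun p => ψ p.1 p.2) : R < ψ.rank := by
  by_contra! hrank
  obtain ⟨hc, hn, hw⟩ := hψ
  have hc' := (productBoundary_mulVec_eq_zero_iff δ₁ δ₂ ψ).mp hc
  obtain ⟨ξ, hξ⟩ := exists_boundary_of_rank_le h₁ h₂ hf₁ hf₂ hR hc' hrank
    (card_heavy_le hD ((sum_hammingNorm_row ψ).trans_le hw))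
    (card_heavy_le hD ((sum_hammingNorm_col ψ).trans_le hw))
    (fun i hi => by simpa using hi) (fun i hi => by simpa using hi)
  refine hn ⟨fun p => ξ p.1 p.2, ?_⟩
  rw [Matrix.mulVecLin_apply, productBoundary_mulVec, hξ]

open Classical in
theorem card_light_cycle_of_rank_mul_le {M L H : ℕ} (hM : M = 2 * L + H) {R D k v : ℕ}
    (hv : ((Finset.univ : Finset (Fin M × Fin M → ZMod 2)).filter
      fun x => hammingNorm x ≤ D).card ≤ 2 ^ v) (hk : 2 * k ≤ R + 2) :
    ((boundaryOperators M H ×ˢ boundaryOperators M H).filter fun p =>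
      ∃ ψ : Matrix (Fin M) (Fin M) (ZMod 2), R < ψ.rank ∧
        IsLightNontrivialCycle (productBoundary p.1 p.2) D fun q => ψ q.1 q.2).card * 2 ^ (L * k) ≤
      (boundaryOperators M H).card ^ 2 * 2 ^ (v + k) := by
  set Ω := boundaryOperators M H with hΩ
  let 𝒳 := ((Finset.univ : Finset (Fin M × Fin M → ZMod 2)).filter fun x => hammingNorm x ≤ D).filter
    fun x => R < (Matrix.of fun i j => x (i, j)).rank
  let I := Ω ×ˢ 𝒳
  let P : Matrix (Fin M) (Fin M) (ZMod 2) × Matrix (Fin M) (Fin M) (ZMod 2) →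
      (Fin M × Fin M → ZMod 2) → Prop := fun p x =>
    p.1 * (Matrix.of fun i j => x (i, j)) = (Matrix.of fun i j => x (i, j)) * p.2.transpose
  have hsub : ∀ p ∈ (Ω ×ˢ Ω).filter (fun p => ∃ ψ : Matrix (Fin M) (Fin M) (ZMod 2), R < ψ.rank ∧
        IsLightNontrivialCycle (productBoundary p.1 p.2) D fun q => ψ q.1 q.2),
      p ∈ Ω ×ˢ Ω ∧ ∃ x ∈ 𝒳, P p x := by
    intro p hp
    rw [Finset.mem_filter] at hp
    obtain ⟨hp, ψ, hr, hc, -, hw⟩ := hp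
    refine ⟨hp, fun q => ψ q.1 q.2, ?_, (productBoundary_mulVec_eq_zero_iff _ _ ψ).mp hc⟩
    rw [Finset.mem_filter, Finset.mem_filter]
    exact ⟨⟨Finset.mem_univ _, hw⟩, hr⟩
  have hterm : ∀ x ∈ 𝒳, ((Ω ×ˢ Ω).filter fun p => P p x).card * 2 ^ (L * k) ≤
      Ω.card ^ 2 * 2 ^ k := by
    intro x hx
    have hr := (Finset.mem_filter.mp hx).2
    -- Once `δ₂` is fixed, the right-hand side of the cycle equation is a fixed matrix `Y`.
    have e : ((Ω ×ˢ Ω).filter fun p => P p x).card =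
        ∑ δ₂ ∈ Ω, (Ω.filter fun δ₁ => P (δ₁, δ₂) x).card := by
      simp only [Finset.card_filter]
      rw [Finset.sum_product_right]
    rw [e, Finset.sum_mul]
    calc _ ≤ ∑ δ₂ ∈ Ω, Ω.card * 2 ^ k := by
          refine Finset.sum_le_sum fun δ₂ _ => ?_
          exact card_mul_eq_mul_le hM (ψ := Matrix.of fun i j => x (i, j))
            (Y := (Matrix.of fun i j => x (i, j)) * δ₂.transpose) (by omega)
      _ = _ := by rw [Finset.sum_const, smul_eq_mul]; ring
  calc _ ≤ (∑ x ∈ 𝒳, ((Ω ×ˢ Ω).filter fun p => P p x).card) * 2 ^ (L * k) :=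
        Nat.mul_le_mul_right _ (card_le_sum_card_filter hsub)
    _ ≤ ∑ x ∈ 𝒳, Ω.card ^ 2 * 2 ^ k := by
        rw [Finset.sum_mul]
        exact Finset.sum_le_sum hterm
    _ = 𝒳.card * (Ω.card ^ 2 * 2 ^ k) := by rw [Finset.sum_const, smul_eq_mul]
    _ ≤ 2 ^ v * (Ω.card ^ 2 * 2 ^ k) :=
        Nat.mul_le_mul_right _ ((Finset.card_filter_le _ _).trans hv)
    _ = _ := by rw [pow_add]; ring

open Classical in
/-- Few product complexes have a light nontrivial cycle. -/
theorem card_light_cycle_mul_le {M L H : ℕ} (hM : M = 2 * L + H) {w v R u k D v' : ℕ}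
    (hv : ((Finset.univ : Finset (Finset (Fin M))).filter fun T => T.card ≤ w).card ≤ 2 ^ v)
    (hv' : ((Finset.univ : Finset (Fin M × Fin M → ZMod 2)).filter
      fun x => hammingNorm x ≤ D).card ≤ 2 ^ v') (hR : 1 ≤ R) (hD : D < (w + 1) * (w + 1))
    (hL : 4 * v + R + 3 * w + 1 + u ≤ L) (hk : 2 * k ≤ R + 2) (hkL : v' + k + u ≤ L * k) :
    ((boundaryOperators M H ×ˢ boundaryOperators M H).filter fun p =>
      ∃ x, IsLightNontrivialCycle (productBoundary p.1 p.2) D x).card * 2 ^ u ≤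
      (2 * R + 1) * (boundaryOperators M H).card ^ 2 := by
  have h1 := card_not_hasFewLightCycles_mul_le hM hv hL
  have h2 := card_light_cycle_of_rank_mul_le hM hv' hk
  set Ω := boundaryOperators M H with hΩ
  set N := Ω.filter fun δ => ¬ HasFewLightCycles δ w R
  set X := (Ω ×ˢ Ω).filter fun p => ∃ ψ : Matrix (Fin M) (Fin M) (ZMod 2), R < ψ.rank ∧
    IsLightNontrivialCycle (productBoundary p.1 p.2) D fun q => ψ q.1 q.2
  have hX : X.card * 2 ^ u ≤ Ω.card ^ 2 := by
    refine Nat.le_of_mul_le_mul_right ?_ (show 0 < 2 ^ (v' + k) by positivity)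
    refine le_trans ?_ h2
    rw [mul_assoc, ← pow_add, add_comm u]
    exact Nat.mul_le_mul_left _ (Nat.pow_le_pow_right (by norm_num) hkL)
  have hsub : ((Ω ×ˢ Ω).filter fun p =>
      ∃ x, IsLightNontrivialCycle (productBoundary p.1 p.2) D x) ⊆ (N ×ˢ Ω ∪ Ω ×ˢ N) ∪ X := by
    intro p hp
    rw [Finset.mem_filter, Finset.mem_product] at hp
    obtain ⟨⟨hp1, hp2⟩, x, hx⟩ := hp
    by_cases hf₁ : HasFewLightCycles p.1 w R
    · by_cases hf₂ : HasFewLightCycles p.2 w R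
      · refine Finset.mem_union_right _ (Finset.mem_filter.mpr ⟨Finset.mem_product.mpr ⟨hp1, hp2⟩,
          Matrix.of fun i j => x (i, j), ?_, hx⟩)
        exact lt_rank_of_isLightNontrivialCycle ((mem_boundaryOperators hM).mp hp1).1
          ((mem_boundaryOperators hM).mp hp2).1 hf₁ hf₂ hR hD hx
      · refine Finset.mem_union_left _ (Finset.mem_union_right _ ?_)
        exact Finset.mem_product.mpr ⟨hp1, Finset.mem_filter.mpr ⟨hp2, hf₂⟩⟩
    · refine Finset.mem_union_left _ (Finset.mem_union_left _ ?_)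
      exact Finset.mem_product.mpr ⟨Finset.mem_filter.mpr ⟨hp1, hf₁⟩, hp2⟩
  have hcard := (Finset.card_le_card hsub).trans (Finset.card_union_le _ _)
  have hcard' := Finset.card_union_le (N ×ˢ Ω) (Ω ×ˢ N)
  rw [Finset.card_product, Finset.card_product] at hcard'
  calc _ ≤ (N.card * Ω.card + Ω.card * N.card + X.card) * 2 ^ u :=
        Nat.mul_le_mul_right _ (hcard.trans (Nat.add_le_add_right hcard' _))
    _ = 2 * (N.card * 2 ^ u) * Ω.card + X.card * 2 ^ u := by ring
    _ ≤ 2 * (R * Ω.card) * Ω.card + Ω.card ^ 2 := by gcongr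
    _ = _ := by ring

/-! ### From light cycles to the distance, and choice of constants. -/

theorem productBoundary_transpose {M : ℕ} (δ₁ δ₂ : Matrix (Fin M) (Fin M) (ZMod 2)) :
    (productBoundary δ₁ δ₂).transpose = productBoundary δ₁.transpose δ₂.transpose := by
  rw [productBoundary, productBoundary, Matrix.transpose_add, ← Matrix.kroneckerMap_transpose,
    ← Matrix.kroneckerMap_transpose, Matrix.transpose_one]

theorem exists_isLightNontrivialCycle_of_cycleDistance_lt {n : Type*} [Fintype n]
    {δ : Matrix n n (ZMod 2)} {x : ℝ} {D : ℕ} (hD : ⌊x⌋₊ ≤ D)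
    (h : (cycleDistance δ : ℝ≥0∞) < ENNReal.ofReal x) : ∃ v, IsLightNontrivialCycle δ D v := by
  by_contra! hc
  refine h.not_ge ?_
  have h1 : ((⌈x⌉₊ : ℕ) : ℕ∞) ≤ cycleDistance δ := by
    refine le_iInf₂ fun v hv => ?_
    rw [Nat.cast_le, Nat.ceil_le]
    by_contra! hlt
    exact hc v ⟨hv.1, hv.2, (Nat.le_floor hlt.le).trans hD⟩
  have h2 : (((⌈x⌉₊ : ℕ) : ℕ∞) : ℝ≥0∞) ≤ (cycleDistance δ : ℝ≥0∞) := ENat.toENNReal_le.mpr h1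
  refine le_trans ?_ h2
  rw [ENat.toENNReal_coe, ← ENNReal.ofReal_natCast]
  exact ENNReal.ofReal_le_ofReal (Nat.le_ceil x)

-- Transposing both factors injects the pairs with a light nontrivial cocycle into those with a
-- light nontrivial cycle, whence the factor 2.
open Classical in
theorem probDistanceLT_le {M L H : ℕ} (hM : M = 2 * L + H) {D : ℕ} {c B : ℝ}
    (hD : ⌊c * (M : ℝ) ^ 2⌋₊ ≤ D) (hB : 0 ≤ B)
    (h : (((boundaryOperators M H ×ˢ boundaryOperators M H).filter fun p =>
      ∃ x, IsLightNontrivialCycle (productBoundary p.1 p.2) D x).card : ℝ) ≤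
        B * ((boundaryOperators M H).card : ℝ) ^ 2) :
    probDistanceLT M H c ≤ 2 * B := by
  set Ω := boundaryOperators M H with hΩ
  set X := (Ω ×ˢ Ω).filter fun p => ∃ x, IsLightNontrivialCycle (productBoundary p.1 p.2) D x
    with hX
  set Y := (Ω ×ˢ Ω).filter fun p =>
    ∃ x, IsLightNontrivialCycle (productBoundary p.1 p.2).transpose D x with hY
  have hYX : Y.card ≤ X.card := by
    refine Finset.card_le_card_of_injOn (fun p => (p.1.transpose, p.2.transpose)) ?_ ?_
    · intro p hp
      rw [Finset.mem_coe, hY, Finset.mem_filter, Finset.mem_product, productBoundary_transpose] at hp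
      rw [Finset.mem_coe, hX, Finset.mem_filter, Finset.mem_product]
      exact ⟨⟨transpose_mem_boundaryOperators hM hp.1.1,
        transpose_mem_boundaryOperators hM hp.1.2⟩, hp.2⟩
    · rintro ⟨a, b⟩ _ ⟨a', b'⟩ _ hab
      rw [Prod.mk.injEq] at hab ⊢
      exact ⟨Matrix.transpose_injective hab.1, Matrix.transpose_injective hab.2⟩
  have hsub : ((Ω ×ˢ Ω).filter fun p => (codeDistance (productBoundary p.1 p.2) : ℝ≥0∞) <
      ENNReal.ofReal (c * (M : ℝ) ^ 2)) ⊆ X ∪ Y := by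
    intro p hp
    rw [Finset.mem_filter] at hp
    rw [Finset.mem_union]
    obtain ⟨hp, hd⟩ := hp
    rcases min_choice (cycleDistance (productBoundary p.1 p.2))
      (cycleDistance (productBoundary p.1 p.2).transpose) with he | he
    · left
      rw [codeDistance, he] at hd
      exact Finset.mem_filter.mpr ⟨hp, exists_isLightNontrivialCycle_of_cycleDistance_lt hD hd⟩
    · right
      rw [codeDistance, he] at hd
      exact Finset.mem_filter.mpr ⟨hp, exists_isLightNontrivialCycle_of_cycleDistance_lt hD hd⟩
  have hcard : ((Ω ×ˢ Ω).filter fun p => (codeDistance (productBoundary p.1 p.2) : ℝ≥0∞) <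
      ENNReal.ofReal (c * (M : ℝ) ^ 2)).card ≤ 2 * X.card := by
    have := (Finset.card_le_card hsub).trans (Finset.card_union_le _ _)
    omega
  rw [probDistanceLT, Finset.card_product]
  -- `boundaryOperators M H` need not be shown nonempty, as a quotient by zero is zero.
  refine div_le_of_le_mul₀ (by positivity) (by positivity) ?_
  calc _ ≤ ((2 * X.card : ℕ) : ℝ) := Nat.cast_le.mpr hcard
    _ ≤ 2 * (B * (Ω.card : ℝ) ^ 2) := by
        push_cast
        linarith
    _ = _ := by
        push_cast
        ring

theorem natCast_le_two_pow_ceil {n : ℕ} {x : ℝ} (h : (n : ℝ) ≤ (2 : ℝ) ^ x) : n ≤ 2 ^ ⌈x⌉₊ := by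
  have h1 : (2 : ℝ) ^ x ≤ (2 : ℝ) ^ ((⌈x⌉₊ : ℕ) : ℝ) :=
    Real.rpow_le_rpow_of_exponent_le (by norm_num) (Nat.le_ceil x)
  rw [Real.rpow_natCast] at h1
  exact_mod_cast h.trans h1

theorem tendsto_two_mul_div_two_pow :
    Filter.Tendsto (fun M : ℕ => 2 * ((2 * (M : ℝ) + 1) / 2 ^ (M / 16))) Filter.atTop (nhds 0) := by
  have h1 : Filter.Tendsto (fun n : ℕ => (n : ℝ) ^ 1 / 2 ^ n) Filter.atTop (nhds 0) :=
    tendsto_pow_const_div_const_pow_of_one_lt 1 (by norm_num)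
  have h2 : Filter.Tendsto (fun n : ℕ => (1 / 2 : ℝ) ^ n) Filter.atTop (nhds 0) :=
    tendsto_pow_atTop_nhds_zero_of_lt_one (by norm_num) (by norm_num)
  have h3 : Filter.Tendsto (fun M : ℕ => M / 16) Filter.atTop Filter.atTop :=
    Nat.tendsto_div_const_atTop (by norm_num)
  have h4 := ((h1.const_mul 64).add (h2.const_mul 64)).comp h3
  simp only [mul_zero, add_zero] at h4
  refine squeeze_zero (fun M => by positivity) (fun M => ?_) h4
  have h5 : (M : ℝ) ≤ 16 * ((M / 16 : ℕ) : ℝ) + 15 := by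
    have : M ≤ 16 * (M / 16) + 15 := by omega
    exact_mod_cast this
  have h6 : (0 : ℝ) < 2 ^ (M / 16) := by positivity
  rw [Function.comp_apply, pow_one, one_div, inv_pow, ← div_eq_mul_inv 64, ← mul_div_assoc,
    ← mul_div_assoc, ← add_div]
  gcongr
  linarith

theorem mainTheorem2 :
    ∃ c₀ : ℝ, 0 < c₀ ∧ ∃ ρ₀ : ℝ, 0 < ρ₀ ∧
      ∀ c : ℝ, 0 < c → c ≤ c₀ →
        ∀ ε : ℝ, 0 < ε → ∃ M₀ : ℕ, ∀ M : ℕ, M₀ ≤ M →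
          ∀ L H : ℕ, M = 2 * L + H → (H : ℝ) ≤ ρ₀ * (M : ℝ) →
            probDistanceLT M H c ≤ ε := by
  obtain ⟨θ₁, hθ₁, hball₁⟩ := exists_card_hammingBall_le (h := 1 / 512) (by norm_num)
  obtain ⟨θ₂, hθ₂, hball₂⟩ := exists_card_hammingBall_le (h := 1 / 1024) (by norm_num)
  set θ := min θ₁ (1 / 512) with hθ
  have hθ0 : 0 < θ := lt_min hθ₁ (by norm_num)
  -- `c ≤ θ ^ 2` leaves at most `w` heavy rows and columns, `c ≤ θ₂` bounds the number of light
  -- matrices, and the rate `1 / 2` gives `L ≥ M / 4`.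
  refine ⟨min (θ ^ 2) θ₂, lt_min (by positivity) hθ₂, 1 / 2, by norm_num, ?_⟩
  intro c hc hc₀ ε hε
  obtain ⟨M₁, hM₁⟩ := Filter.eventually_atTop.mp
    (tendsto_two_mul_div_two_pow.eventually (eventually_le_nhds hε))
  refine ⟨max M₁ 1000, fun M hM L H hML hH => ?_⟩
  have hM1000 : 1000 ≤ M := (le_max_right _ _).trans hM
  have hMr : (1000 : ℝ) ≤ M := by exact_mod_cast hM1000
  refine le_trans ?_ (hM₁ M ((le_max_left _ _).trans hM))
  have hL4 : M ≤ 4 * L := by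
    have : (2 : ℝ) * H ≤ M := by linarith
    have : 2 * H ≤ M := by exact_mod_cast this
    omega
  set w := ⌊θ * M⌋₊ with hw
  set v := ⌈(1 / 512 : ℝ) * M⌉₊ with hv
  set D := ⌊c * (M : ℝ) ^ 2⌋₊ with hD
  set v' := ⌈(1 / 1024 : ℝ) * ((M * M : ℕ) : ℝ)⌉₊ with hv'
  have hwle : (w : ℝ) ≤ θ * M := Nat.floor_le (by positivity)
  have hwlt : θ * M < w + 1 := Nat.lt_floor_add_one _
  have hDle : (D : ℝ) ≤ c * (M : ℝ) ^ 2 := Nat.floor_le (by positivity)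
  have hvlt : (v : ℝ) < (1 / 512 : ℝ) * M + 1 := Nat.ceil_lt_add_one (by positivity)
  have hv'lt : (v' : ℝ) < (1 / 1024 : ℝ) * ((M * M : ℕ) : ℝ) + 1 :=
    Nat.ceil_lt_add_one (by positivity)
  have hballw : ((Finset.univ : Finset (Finset (Fin M))).filter fun T => T.card ≤ w).card ≤
      2 ^ v := by
    apply natCast_le_two_pow_ceil
    have := hball₁ (Fin M)
    rw [Fintype.card_fin] at this
    refine le_trans (Nat.cast_le.mpr (Finset.card_le_card fun T hT => ?_)) this
    rw [Finset.mem_filter] at hT ⊢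
    refine ⟨hT.1, ?_⟩
    calc (T.card : ℝ) ≤ w := Nat.cast_le.mpr hT.2
      _ ≤ θ * M := hwle
      _ ≤ θ₁ * M := by
        gcongr
        exact min_le_left _ _
  have hballD : ((Finset.univ : Finset (Fin M × Fin M → ZMod 2)).filter
      fun x => hammingNorm x ≤ D).card ≤ 2 ^ v' := by
    refine (card_hammingNorm_le (· ≤ D)).trans (natCast_le_two_pow_ceil ?_)
    have := hball₂ (Fin M × Fin M)
    rw [Fintype.card_prod, Fintype.card_fin] at this
    refine le_trans (Nat.cast_le.mpr (Finset.card_le_card fun T hT => ?_)) this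
    rw [Finset.mem_filter] at hT ⊢
    refine ⟨hT.1, ?_⟩
    calc (T.card : ℝ) ≤ D := Nat.cast_le.mpr hT.2
      _ ≤ c * (M : ℝ) ^ 2 := hDle
      _ ≤ θ₂ * (M : ℝ) ^ 2 := by
        gcongr
        exact hc₀.trans (min_le_right _ _)
      _ = θ₂ * ((M * M : ℕ) : ℝ) := by
        push_cast
        ring
  have hDw : D < (w + 1) * (w + 1) := by
    have : (D : ℝ) < (w + 1) * (w + 1) := by
      calc (D : ℝ) ≤ c * (M : ℝ) ^ 2 := hDle
        _ ≤ θ ^ 2 * (M : ℝ) ^ 2 := by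
          gcongr
          exact hc₀.trans (min_le_left _ _)
        _ = (θ * M) * (θ * M) := by ring
        _ < (w + 1) * (w + 1) := by
          apply mul_lt_mul'' hwlt hwlt <;> positivity
    exact_mod_cast this
  have hw512 : 512 * w ≤ M := by
    have : (w : ℝ) ≤ 1 / 512 * M := hwle.trans (by gcongr; exact min_le_right _ _)
    have : (512 : ℝ) * w ≤ M := by linarith
    exact_mod_cast this
  have hv512 : 512 * v ≤ M + 512 := by
    have : (512 : ℝ) * v ≤ M + 512 := by linarith
    exact_mod_cast this
  have hv1024 : 1024 * v' ≤ M * M + 1024 := by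
    have : (1024 : ℝ) * v' ≤ ((M * M : ℕ) : ℝ) + 1024 := by linarith
    exact_mod_cast this
  -- The main terms are `M ^ 2 / 1024` on the left and at least `M ^ 2 / 256` on the right; `M ≥
  -- 1000` absorbs the linear terms and the rounding.
  have hLk : v' + M / 64 + M / 16 ≤ L * (M / 64) := by
    have e1 : M ≤ 64 * (M / 64) + 63 := by omega
    have e2 : M / 16 ≤ 4 * (M / 64) + 3 := by omega
    set k := M / 64 with hk
    have e3 : 15 ≤ k := by omega
    nlinarith
  -- The condition on `L` reads about `M * (4 / 512 + 1 / 32 + 3 / 512 + 1 / 16) ≤ M / 4`.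
  have key := card_light_cycle_mul_le hML (R := M / 32) (u := M / 16) (k := M / 64) hballw hballD
    (by omega) hDw (by omega) (by omega) hLk
  refine probDistanceLT_le hML (D := D) le_rfl (by positivity) ?_
  rw [div_mul_eq_mul_div, le_div_iff₀ (by positivity)]
  calc _ ≤ (2 * ((M / 32 : ℕ) : ℝ) + 1) * ((boundaryOperators M H).card : ℝ) ^ 2 := by
        exact_mod_cast key
    _ ≤ _ := by
        gcongr
        exact_mod_cast Nat.div_le_self M 32
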